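/- Let $\mathcal{C}=\{(\chi,\tau)\in\mathbb{R}_{\ge 0}^2:\ 16\tau^4+(8\chi^2-72\chi+108)\tau^2+\chi^4-2\chi^3<0\}$, a bounded relatively open subset of the closed first quadrant, and let $X=\mathbb{R}_{\ge 0}^2\setminus\overline{\mathcal{C}}$. For each $(\chi,\tau)\in X$ there is exactly one pair of real numbers $A=A(\chi,\tau)$, $B=B(\chi,\tau)>0$ for which there exist $u,v\in\mathbb{R}$, a Schwarz-symmetric simple arc $\Sigma_g$ joining $A-\mathrm{i}B$ to $A+\mathrm{i}B$ with $\pm\mathrm{i}\notin\Sigma_g$, and a function $R$ analytic on $\mathbb{C}\setminus\Sigma_g$ with $R(\lambda)^2=(\lambda-A)^2+B^2$ and $R(\lambda)=\lambda+O(1)$ as $\lambda\to\infty$, such that $$h'(\lambda)=\frac{2\tau\lambda^2+u\lambda+v}{\lambda^2+1}R(\lambda)$$ satisfies $\operatorname{Res}_{\lambda=\pm\mathrm{i}}h'(\lambda)=\pm\mathrm{i}$ and $h'(\lambda)=2\tau\lambda+\chi+O(\lambda^{-2})$ as $\lambda\to\infty$. Put $$\gamma(\chi,\tau)=\chi A+\tau\left(A^2-\tfrac12B^2\right)+\mathrm{i}\int_{-\mathrm{i}}^{A-\mathrm{i}B}\frac{\mathrm{d}\lambda}{R(\lambda)}+\mathrm{i}\int_{A+\mathrm{i}B}^{\mathrm{i}}\frac{\mathrm{d}\lambda}{R(\lambda)},$$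 with paths of integration in the part of the open lower (respectively upper) half-plane complementary to $\Sigma_g$; this is a real number independent of the choice of $\Sigma_g$ and of the paths. Then $\gamma$, $\rho:=B^2$ and $U:=-2\gamma_\chi$ are continuously differentiable on $X$, and they satisfy the dispersionless focusing nonlinear Schr\"odinger system (genus-zero Whitham system) $$\rho_\tau+(\rho U)_\chi=0,\qquad U_\tau+\left(\tfrac12U^2-\rho\right)_\chi=0$$ at every point of $X$, derivatives at points of $X$ on the coordinate axes being one-sided within the closed first quadrant. -/

import Mathlib

open Set Filter Topology Bornology Asymptotics

noncomputable section

namespace RogueWave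

/-- The bounded relatively open subset `𝒞` of the closed first quadrant that is bordered by the
curve `16τ⁴ + (8χ² - 72χ + 108)τ² + χ⁴ - 2χ³ = 0`.  The polynomial is a negative multiple of the
discriminant of the cubic `2τz³ + χz² + 2τz + χ - 2`, whose roots are the critical points of
`z ↦ χz + τz² + i log((z - i)/(z + i))`. -/
def channels : Set (ℝ × ℝ) :=
  {x | 0 ≤ x.1 ∧ 0 ≤ x.2 ∧
    16 * x.2 ^ 4 + (8 * x.1 ^ 2 - 72 * x.1 + 108) * x.2 ^ 2 + x.1 ^ 4 - 2 * x.1 ^ 3 < 0}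

/-- The part of the closed first quadrant exterior to the closure of `𝒞`. -/
def exterior : Set (ℝ × ℝ) :=
  (Ici 0 ×ˢ Ici 0) \ closure channels

/-- `S` is a Schwarz-symmetric simple arc from `A - iB` to `A + iB` avoiding `±i`
(an admissible branch cut `Σ_g`). -/
def IsBranchCut (A B : ℝ) (S : Set ℂ) : Prop :=
  (∃ c : ℝ → ℂ, ContinuousOn c (Icc 0 1) ∧ InjOn c (Icc 0 1) ∧
      c 0 = (A : ℂ) - B * Complex.I ∧ c 1 = (A : ℂ) + B * Complex.I ∧ S = c '' Icc 0 1) ∧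
    (∀ z ∈ S, (starRingEnd ℂ) z ∈ S) ∧
    Complex.I ∉ S ∧ -Complex.I ∉ S

/-- `R` is the function analytic on `ℂ \ S` with `R(z)² = (z - A)² + B²` and
`R(z) = z + O(1)` as `z → ∞`. -/
def IsRootFunction (A B : ℝ) (S : Set ℂ) (R : ℂ → ℂ) : Prop :=
  DifferentiableOn ℂ R Sᶜ ∧
    (∀ z ∉ S, R z ^ 2 = (z - A) ^ 2 + (B : ℂ) ^ 2) ∧
    (fun z => R z - z) =O[cobounded ℂ] (fun _ => (1 : ℂ))

/-- The genus-zero form `h'(z) = (2τz² + uz + v)/(z² + 1) · R(z)`. -/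
def hDeriv (τ u v : ℝ) (R : ℂ → ℂ) (z : ℂ) : ℂ :=
  (2 * τ * z ^ 2 + u * z + v) / (z ^ 2 + 1) * R z

/-- `A`, `B > 0`, `u`, `v`, the cut `S` and the square root `R` determine a genus-zero modified
phase for `(χ, τ)`: the derivative `h'` has residues `±i` at its simple poles `±i`, and
`h'(z) = 2τz + χ + O(z⁻²)` as `z → ∞`. -/
structure IsGenusZero (χ τ A B u v : ℝ) (S : Set ℂ) (R : ℂ → ℂ) : Prop where
  pos : 0 < B
  cut : IsBranchCut A B S
  root : IsRootFunction A B S R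
  residue_upper :
    Tendsto (fun z => (z - Complex.I) * hDeriv τ u v R z) (𝓝[≠] Complex.I) (𝓝 Complex.I)
  residue_lower :
    Tendsto (fun z => (z + Complex.I) * hDeriv τ u v R z) (𝓝[≠] (-Complex.I)) (𝓝 (-Complex.I))
  expansion :
    (fun z => hDeriv τ u v R z - (2 * τ * z + χ)) =O[cobounded ℂ] (fun z => (z ^ 2)⁻¹)

/-- `A ± iB` (with `B > 0`) are the branch points of a genus-zero modified phase for `(χ, τ)`. -/
def IsBranchPoint (χ τ A B : ℝ) : Prop :=
  ∃ (u v : ℝ) (S : Set ℂ) (R : ℂ → ℂ), IsGenusZero χ τ A B u v S R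

/-- The pair `(A(χ, τ), B(χ, τ))`. -/
def branchPoint (χ τ : ℝ) : ℝ × ℝ :=
  Classical.epsilon fun w : ℝ × ℝ => IsBranchPoint χ τ w.1 w.2

/-- `A(χ, τ)`, the real part of the branch point in the upper half-plane. -/
def A (χ τ : ℝ) : ℝ := (branchPoint χ τ).1

/-- `B(χ, τ)`, the imaginary part of the branch point in the upper half-plane. -/
def B (χ τ : ℝ) : ℝ := (branchPoint χ τ).2

/-- `p` parametrizes over `[0, 1]` a path from `a` to `b` inside the half-plane `H`, disjoint from
the cut `S` except perhaps at its endpoints, along which `1 / R` is absolutely integrable. -/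
structure IsPath (H S : Set ℂ) (R : ℂ → ℂ) (a b : ℂ) (p : ℝ → ℂ) : Prop where
  continuousOn : ContinuousOn p (Icc 0 1)
  differentiableOn : DifferentiableOn ℝ p (Ioo 0 1)
  source : p 0 = a
  target : p 1 = b
  mem : ∀ t ∈ Icc (0 : ℝ) 1, p t ∈ H
  notMem : ∀ t ∈ Ioo (0 : ℝ) 1, p t ∉ S
  integrable : IntervalIntegrable (fun t => deriv p t / R (p t)) MeasureTheory.volume 0 1

/-- The contour integral of `1 / R` along `p`. -/
def pathIntegral (R : ℂ → ℂ) (p : ℝ → ℂ) : ℂ :=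
  ∫ t in (0 : ℝ)..1, deriv p t / R (p t)

/-- `g` is the value at `(χ, τ)` of the phase
`χA + τ(A² - B²/2) + i ∫_{-i}^{A-iB} dz/R(z) + i ∫_{A+iB}^{i} dz/R(z)`, the integrals being taken
along some paths in the lower and upper half-planes, in the complement of the cut. -/
def IsPhase (χ τ g : ℝ) : Prop :=
  ∃ (u v : ℝ) (S : Set ℂ) (R : ℂ → ℂ) (p q : ℝ → ℂ),
    IsGenusZero χ τ (A χ τ) (B χ τ) u v S R ∧
    IsPath {z | z.im < 0} S R (-Complex.I) ((A χ τ : ℂ) - B χ τ * Complex.I) p ∧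
    IsPath {z | 0 < z.im} S R ((A χ τ : ℂ) + B χ τ * Complex.I) Complex.I q ∧
    (g : ℂ) = (χ * A χ τ + τ * (A χ τ ^ 2 - 1 / 2 * B χ τ ^ 2) : ℝ)
      + Complex.I * pathIntegral R p + Complex.I * pathIntegral R q

/-- The phase `γ(χ, τ)`. -/
def gamma (χ τ : ℝ) : ℝ := Classical.epsilon fun g : ℝ => IsPhase χ τ g

/-- The partial derivative with respect to `χ` in the closed first quadrant
(one-sided where `χ = 0`). -/
def dChi (f : ℝ → ℝ → ℝ) (χ τ : ℝ) : ℝ := derivWithin (fun s => f s τ) (Ici 0) χ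

/-- The partial derivative with respect to `τ` in the closed first quadrant
(one-sided where `τ = 0`). -/
def dTau (f : ℝ → ℝ → ℝ) (χ τ : ℝ) : ℝ := derivWithin (fun t => f χ t) (Ici 0) τ

/-- The density `ρ = B²`. -/
def rho (χ τ : ℝ) : ℝ := B χ τ ^ 2

/-- The velocity `U = -2 γ_χ`. -/
def U (χ τ : ℝ) : ℝ := -2 * dChi gamma χ τ

end RogueWave

end

/-! Write R(i) = p + iq. Squaring gives A = -pq and B² = (1 + p²)(1 - q²), so that B > 0 forces q² <
1. The expansion at infinity expresses u and v through χ, τ, A, B (`IsRootFunction.expansion_iff`),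
and the residues then force R(-i) = p - iq and turn the conditions into (χ, τ) = `rootMap` (p, q),
an explicit rational map (`IsGenusZero.isRootPair`). The problem becomes the inversion of this map.

Global inversion (`existsUnique_isRootPair`): for τ > 0, q can be eliminated, leaving τ *
`resolvent` (χ/τ) p = 2 on the set of p > 0 where q < 1. That set is a half-line, possibly with a
compact interval [α, β] removed. The resolvent increases on each remaining piece, and `channelPoly`
is a positive multiple of the product of the values of τ * `resolvent` - 2 at α and β. If this
product is positive, exactly one piece contains a solution. Local inversion (`rootPair_local`): the
Jacobian does not vanish when q² < 1, so the global inverse is C¹ and its derivatives are explicit.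

Conversely every root pair with p, q ≥ 0 comes from a genuine cut and root function
(`exists_cut_and_paths`): a circular arc from A - iB to A + iB can be chosen so that R(i) has the
prescribed sign.

For the phase, dz/R = d log(z - A + R). On the half-planes this quantity stays off the real axis, so
the principal logarithm evaluates the integrals along any path, and together they contribute 2
arctan p (`IsGenusZero.phase_eq`). The resulting function of (χ, τ, p, q) is stationary in (p, q) at
the root pair, whence γ_χ = A = -pq and U = 2pq. With ρ and U explicit in (p, q) and the derivatives
of p, q known, the two equations are rational identities. -/

noncomputable section

namespace RogueWave

open ComplexConjugate

/-! ### Positivity of the quartic on the exterior -/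

/-- The polynomial whose sign defines `channels`. -/
def channelPoly (χ τ : ℝ) : ℝ :=
  16 * τ ^ 4 + (8 * χ ^ 2 - 72 * χ + 108) * τ ^ 2 + χ ^ 4 - 2 * χ ^ 3

/-- Completing the square in T = τ². The zero set is thus confined to χ ≤ 9/4, with a cusp at χ =
9/4. -/
lemma channelPoly_sqrt (χ : ℝ) {T : ℝ} (hT : 0 ≤ T) :
    channelPoly χ √T = 16 * (T + (χ ^ 2 - 9 * χ + 27 / 2) / 4) ^ 2 + 16 * (χ - 9 / 4) ^ 3 := by
  have h4 : √T ^ 4 = T ^ 2 := by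
    rw [show √T ^ 4 = (√T ^ 2) ^ 2 by ring, Real.sq_sqrt hT]
  rw [channelPoly, h4, Real.sq_sqrt hT]
  ring

lemma mem_channels_of_sqrt {χ T : ℝ} (hχ : 0 ≤ χ) (h : channelPoly χ √T < 0) :
    (χ, √T) ∈ channels :=
  ⟨hχ, Real.sqrt_nonneg T, h⟩

/-- Where the quartic is negative the point lies in `channels`; what needs proof is that each zero
in the closed quadrant is a limit of such points, found by moving along a suitable curve that stays
in the quadrant. -/
lemma channelPoly_pos {x : ℝ × ℝ} (hx : x ∈ exterior) : 0 < channelPoly x.1 x.2 := by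
  obtain ⟨χ, τ⟩ := x
  obtain ⟨⟨hχ, hτ⟩, hc⟩ := hx
  simp only [mem_Ici] at hχ hτ ⊢
  by_contra! hle
  refine hc ?_
  rcases hle.lt_or_eq with hlt | h0
  · exact subset_closure ⟨hχ, hτ, hlt⟩
  have hV := channelPoly_sqrt χ (sq_nonneg τ)
  rw [Real.sqrt_sq hτ, h0] at hV
  set V := -(χ ^ 2 - 9 * χ + 27 / 2) / 4 with hVdef
  have hcube : (χ - 9 / 4) ^ 3 ≤ 0 := by nlinarith [sq_nonneg (τ ^ 2 + (χ ^ 2 - 9 * χ + 27 / 2) / 4)]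
  have hχ9 : χ ≤ 9 / 4 := by
    by_contra! h
    have : 0 < (χ - 9 / 4) ^ 3 := pow_pos (by linarith) 3
    linarith
  have hε : ∀ᶠ ε : ℝ in 𝓝[>] 0, 0 < ε ∧ ε < 1 / 8 :=
    Ioo_mem_nhdsGT (by norm_num)
  rcases hχ9.lt_or_eq with hlt | rfl
  · have hneg : (χ - 9 / 4) ^ 3 < 0 := by
      have : 0 < (9 / 4 - χ) ^ 3 := pow_pos (by linarith) 3
      nlinarith
    -- Moving τ² towards the vertex V of the parabola shrinks the square while the cubic term stays
    -- negative. The disjunction keeps the moved value of τ² nonnegative.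
    have main : (0 < τ ∨ 0 < V) → (χ, τ) ∈ closure channels := by
      intro hor
      have hcont : Tendsto (fun s : ℝ => (1 - s) * τ ^ 2 + s * V) (𝓝[>] 0) (𝓝 (τ ^ 2)) := by
        have : ContinuousAt (fun s : ℝ => (1 - s) * τ ^ 2 + s * V) 0 := by fun_prop
        have h := this.tendsto.mono_left (nhdsWithin_le_nhds (s := Ioi 0))
        simpa using h
      have hpos : ∀ᶠ s : ℝ in 𝓝[>] 0, 0 ≤ (1 - s) * τ ^ 2 + s * V := by
        rcases hor with h | h
        · exact (hcont.eventually (lt_mem_nhds (pow_pos h 2))).mono fun _ h => h.le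
        · filter_upwards [hε] with s hs
          have : 0 ≤ (1 - s) * τ ^ 2 := mul_nonneg (by linarith [hs.2]) (sq_nonneg _)
          have : 0 ≤ s * V := mul_nonneg hs.1.le h.le
          linarith
      have hlim : Tendsto (fun s : ℝ => (χ, √((1 - s) * τ ^ 2 + s * V))) (𝓝[>] 0) (𝓝 (χ, τ)) := by
        refine tendsto_const_nhds.prodMk_nhds ?_
        have := (Real.continuous_sqrt.tendsto (τ ^ 2)).comp hcont
        rwa [Real.sqrt_sq hτ] at this
      refine mem_closure_of_tendsto hlim ?_
      filter_upwards [hε, hpos] with s hs hp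
      refine mem_channels_of_sqrt hχ ?_
      rw [channelPoly_sqrt χ hp]
      have e : (1 - s) * τ ^ 2 + s * V + (χ ^ 2 - 9 * χ + 27 / 2) / 4
          = (1 - s) * (τ ^ 2 + (χ ^ 2 - 9 * χ + 27 / 2) / 4) := by
        rw [hVdef]; ring
      rw [e, mul_pow]
      have h1 : (1 - s) ^ 2 < 1 := by nlinarith [hs.1, hs.2]
      nlinarith
    rcases hτ.lt_or_eq with h | h
    · exact main (Or.inl h)
    · subst h
      have h3 : χ ^ 3 * (χ - 2) = 0 := by
        simp only [channelPoly] at h0; linarith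
      rcases mul_eq_zero.1 h3 with h | h
      -- At the origin V is negative, so the approach is along the χ-axis, where the quartic equals
      -- -χ³(2 - χ).
      · have h : χ = 0 := by simpa using h
        subst h
        have hlim : Tendsto (fun s : ℝ => (s, (0 : ℝ))) (𝓝[>] 0) (𝓝 (0, 0)) :=
          (tendsto_id.mono_left nhdsWithin_le_nhds).prodMk_nhds tendsto_const_nhds
        refine mem_closure_of_tendsto hlim ?_
        filter_upwards [hε] with s hs
        refine ⟨hs.1.le, le_rfl, ?_⟩
        have : 0 < s ^ 3 * (2 - s) := mul_pos (pow_pos hs.1 3) (by linarith [hs.2])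
        simp only
        linarith
      · have h : χ = 2 := by linarith
        subst h
        exact main (Or.inr (by rw [hVdef]; norm_num))
  -- The cusp: it is approached along the curve of vertices τ² = V(χ), where only the cubic term
  -- survives.
  · have hτ2 : τ ^ 2 = 27 / 64 := by
      have : (τ ^ 2 - 27 / 64) ^ 2 = 0 := by nlinarith
      have := pow_eq_zero_iff (two_ne_zero) |>.1 this
      linarith
    let Vf : ℝ → ℝ := fun s => -((9 / 4 - s) ^ 2 - 9 * (9 / 4 - s) + 27 / 2) / 4
    have hcont : Tendsto Vf (𝓝[>] 0) (𝓝 (τ ^ 2)) := by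
      have : ContinuousAt Vf 0 := by fun_prop
      have h := this.tendsto.mono_left (nhdsWithin_le_nhds (s := Ioi 0))
      rw [hτ2]
      convert h using 2
      simp only [Vf]; norm_num
    have hlim : Tendsto (fun s : ℝ => (9 / 4 - s, √(Vf s))) (𝓝[>] 0) (𝓝 (9 / 4, τ)) := by
      refine Tendsto.prodMk_nhds ?_ ?_
      · have : ContinuousAt (fun s : ℝ => 9 / 4 - s) 0 := by fun_prop
        simpa using this.tendsto.mono_left (nhdsWithin_le_nhds (s := Ioi 0))
      · have := (Real.continuous_sqrt.tendsto (τ ^ 2)).comp hcont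
        rwa [Real.sqrt_sq hτ] at this
    refine mem_closure_of_tendsto hlim ?_
    filter_upwards [hε] with s hs
    have hp : 0 ≤ Vf s := by simp only [Vf]; nlinarith [hs.1, hs.2]
    refine mem_channels_of_sqrt (by linarith [hs.2]) ?_
    rw [channelPoly_sqrt _ hp]
    have : 0 < s ^ 3 := pow_pos hs.1 3
    simp only [Vf]
    nlinarith

/-! ### Unique solvability of the algebraic equations for R(i) -/

/-- The real and imaginary parts `p`, `q` of the value `R(i)` satisfy these relations, which
determine the genus-zero modified phase. -/
structure IsRootPair (χ τ p q : ℝ) : Prop where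
  sq_lt : q ^ 2 < 1
  pos : 0 < p ^ 2 + q ^ 2
  tau_eq : τ * ((1 + p ^ 2) * (p ^ 2 + q ^ 2)) = 2 * p
  chi_eq : χ * ((1 + p ^ 2) * (p ^ 2 + q ^ 2)) = 2 * q * (1 + 3 * p ^ 2)

/-- The expression is affine in t. Its value at t = 1 is (s + 1)(3s - 1)² ≥ 0 and its value at t = 0
is s(1 + 3s)²; the sign of the slope decides which endpoint to compare with. It is used with s = p²,
t = q². -/
lemma jacobian_pos {s t : ℝ} (hs : 0 ≤ s) (ht : 0 ≤ t) (ht1 : t < 1) (hst : 0 < s + t) :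
    0 < t * (1 - 6 * s - 3 * s ^ 2) + s * (1 + 3 * s) ^ 2 := by
  rcases le_or_gt 0 (1 - 6 * s - 3 * s ^ 2) with h | h
  · rcases hs.lt_or_eq with h1 | rfl
    · have : 0 < s * (1 + 3 * s) ^ 2 := by positivity
      have := mul_nonneg ht h
      linarith
    · simpa using hst
  · have : 0 ≤ (s + 1) * (3 * s - 1) ^ 2 := by positivity
    nlinarith

/-- Eliminating `q` from the equations of `IsRootPair` leaves `τ * resolvent (χ / τ) p = 2`. -/
def resolvent (k p : ℝ) : ℝ := p * (1 + p ^ 2) * (1 + k ^ 2 / (1 + 3 * p ^ 2) ^ 2)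

lemma hasDerivAt_resolvent (k p : ℝ) :
    HasDerivAt (resolvent k)
      ((1 + 3 * p ^ 2) + k ^ 2 * (1 - 6 * p ^ 2 - 3 * p ^ 4) / (1 + 3 * p ^ 2) ^ 3) p := by
  have hne : (1 + 3 * p ^ 2) ≠ 0 := by positivity
  have h1 : HasDerivAt (fun p : ℝ => p * (1 + p ^ 2)) (1 * (1 + p ^ 2) + p * (2 * p)) p := by
    simpa using (hasDerivAt_id' p).fun_mul (((hasDerivAt_id' p).fun_pow 2).const_add 1)
  have h2 : HasDerivAt (fun p : ℝ => (1 + 3 * p ^ 2) ^ 2)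
      (2 * (1 + 3 * p ^ 2) * (3 * (2 * p))) p := by
    simpa using ((((hasDerivAt_id' p).fun_pow 2).const_mul 3).const_add 1).fun_pow 2
  have h3 := h1.fun_mul (((hasDerivAt_const p (k ^ 2)).fun_div h2 (by positivity)).const_add 1)
  refine h3.congr_deriv ?_
  field_simp
  ring

lemma continuous_resolvent (k : ℝ) : Continuous (resolvent k) :=
  continuous_iff_continuousAt.2 fun p => (hasDerivAt_resolvent k p).continuousAt

/-- After substituting q = kp/(1 + 3p²), the derivative of the resolvent is the numerator of the
Jacobian of `rootMap` divided by p²(1 + 3p²), and the assumed inequality says q < 1. -/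
lemma resolvent_strictMonoOn {k : ℝ} (hk : 0 ≤ k) {I : Set ℝ} (hI : Convex ℝ I)
    (hpos : ∀ p ∈ interior I, 0 < p) (hlt : ∀ p ∈ interior I, k * p < 1 + 3 * p ^ 2) :
    StrictMonoOn (resolvent k) I := by
  refine strictMonoOn_of_deriv_pos hI (continuous_resolvent k).continuousOn fun p hp => ?_
  rw [(hasDerivAt_resolvent k p).deriv]
  have hp0 := hpos p hp
  have hq0 : 0 ≤ k * p / (1 + 3 * p ^ 2) := by positivity
  have hq1 : k * p / (1 + 3 * p ^ 2) < 1 := by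
    rw [div_lt_one (by positivity)]; exact hlt p hp
  have := jacobian_pos (s := p ^ 2) (t := (k * p / (1 + 3 * p ^ 2)) ^ 2) (by positivity)
    (by positivity) (by nlinarith) (by positivity)
  have e : (1 + 3 * p ^ 2) + k ^ 2 * (1 - 6 * p ^ 2 - 3 * p ^ 4) / (1 + 3 * p ^ 2) ^ 3
      = ((k * p / (1 + 3 * p ^ 2)) ^ 2 * (1 - 6 * p ^ 2 - 3 * (p ^ 2) ^ 2)
        + p ^ 2 * (1 + 3 * p ^ 2) ^ 2) / (p ^ 2 * (1 + 3 * p ^ 2)) := by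
    field_simp
    ring
  rw [e]
  positivity

/-- Dividing the two equations gives χp = τq(1 + 3p²), which is linear in q. As q ≥ 0, the bound q²
< 1 becomes a condition on p alone. -/
lemma isRootPair_iff {χ τ p q : ℝ} (hχ : 0 ≤ χ) (hτ : 0 < τ) :
    IsRootPair χ τ p q ↔ 0 < p ∧ τ * resolvent (χ / τ) p = 2 ∧
      q = χ / τ * p / (1 + 3 * p ^ 2) ∧ χ / τ * p < 1 + 3 * p ^ 2 := by
  constructor
  · rintro ⟨h1, h2, h3, h4⟩
    have hn : 0 < (1 + p ^ 2) * (p ^ 2 + q ^ 2) := by positivity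
    have hp : 0 < p := by nlinarith [mul_pos hτ hn]
    have hq : q = χ / τ * p / (1 + 3 * p ^ 2) := by
      have : χ * p = τ * q * (1 + 3 * p ^ 2) := by
        refine mul_left_cancel₀ hn.ne' ?_
        linear_combination p * h4 - q * (1 + 3 * p ^ 2) * h3
      field_simp
      linarith
    have hq1 : q < 1 := by nlinarith
    refine ⟨hp, ?_, hq, ?_⟩
    · have : resolvent (χ / τ) p = (1 + p ^ 2) * (p ^ 2 + q ^ 2) / p := by
        rw [hq, resolvent]
        field_simp
      rw [this]
      field_simp
      linarith
    · rw [hq, div_lt_one (by positivity)] at hq1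
      exact hq1
  · rintro ⟨hp, h1, hq, hlt⟩
    have hq0 : 0 ≤ q := by rw [hq]; positivity
    have hq1 : q < 1 := by rw [hq, div_lt_one (by positivity)]; exact hlt
    have h3 : τ * ((1 + p ^ 2) * (p ^ 2 + q ^ 2)) = 2 * p := by
      have : (1 + p ^ 2) * (p ^ 2 + q ^ 2) = p * resolvent (χ / τ) p := by
        rw [hq, resolvent]
        field_simp
      rw [this]
      linear_combination p * h1
    refine ⟨by nlinarith, by positivity, h3, ?_⟩
    have : χ * p = τ * q * (1 + 3 * p ^ 2) := by
      rw [hq]; field_simp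
    refine mul_left_cancel₀ hp.ne' ?_
    linear_combination ((1 + p ^ 2) * (p ^ 2 + q ^ 2)) * this + q * (1 + 3 * p ^ 2) * h3

/-- At the two points where `q = 1`, the signs of `τ * resolvent - 2` agree off the channels. -/
lemma channelPoly_eq {χ τ α β : ℝ} (hτ : τ ≠ 0) (hs : α + β = χ / τ / 3) (hp : α * β = 1 / 3) :
    channelPoly χ τ = 81 * τ ^ 2 *
      ((τ * (1 + α ^ 2) ^ 2 - 2 * α) * (τ * (1 + β ^ 2) ^ 2 - 2 * β)) := by
  have hχ : χ = 3 * τ * (α + β) := by rw [hs]; field_simp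
  have e : (τ * (1 + α ^ 2) ^ 2 - 2 * α) * (τ * (1 + β ^ 2) ^ 2 - 2 * β)
      = τ ^ 2 * (1 + (α + β) ^ 2 - 2 * (α * β) + (α * β) ^ 2) ^ 2
        - 2 * τ * ((α + β) + 4 * (α * β) * (α + β)
          + (α * β) * ((α + β) ^ 3 - 3 * (α * β) * (α + β)) - 2 * (α * β) * (α + β))
        + 4 * (α * β) := by ring
  rw [e, hp, hχ, channelPoly]
  ring

/-- At a point where q = 1 the resolvent simplifies to (1 + α²)²/α. -/
lemma resolvent_of_root {k α : ℝ} (hα : 0 < α) (h : k * α = 1 + 3 * α ^ 2) (τ : ℝ) :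
    τ * (1 + α ^ 2) ^ 2 - 2 * α = α * (τ * resolvent k α - 2) := by
  rw [resolvent, ← h]
  have hk : k ≠ 0 := by rintro rfl; nlinarith [sq_nonneg α]
  field_simp
  ring

/-- α and β are the roots of 3x² - kx + 1. They are real because 1 + 3p² ≤ kp forces k² ≥ 12 by the
inequality of the means. -/
lemma exists_roots {k p : ℝ} (hk : 0 ≤ k) (hp : 0 < p) (h : 1 + 3 * p ^ 2 ≤ k * p) :
    ∃ α β : ℝ, 0 < α ∧ α ≤ β ∧ α + β = k / 3 ∧ α * β = 1 / 3 := by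
  have hk12 : 12 ≤ k ^ 2 := by
    have h1 : 0 ≤ (k * p - (1 + 3 * p ^ 2)) := by linarith
    have h2 : (1 + 3 * p ^ 2) ^ 2 ≤ (k * p) ^ 2 := by
      apply pow_le_pow_left₀ (by positivity) h
    have h3 : 12 * p ^ 2 ≤ k ^ 2 * p ^ 2 := by nlinarith [sq_nonneg (1 - 3 * p ^ 2)]
    exact le_of_mul_le_mul_right h3 (by positivity)
  have hsq := Real.sq_sqrt (show 0 ≤ k ^ 2 - 12 by linarith)
  have hs0 := Real.sqrt_nonneg (k ^ 2 - 12)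
  have hlt : √(k ^ 2 - 12) < k := by
    rw [Real.sqrt_lt' (by nlinarith)]; linarith
  refine ⟨(k - √(k ^ 2 - 12)) / 6, (k + √(k ^ 2 - 12)) / 6, by linarith, by linarith, by ring, ?_⟩
  linear_combination -hsq / 36

lemma factor_roots {k α β : ℝ} (hs : α + β = k / 3) (hp : α * β = 1 / 3) (p : ℝ) :
    1 + 3 * p ^ 2 - k * p = 3 * ((p - α) * (p - β)) := by
  have : k = 3 * (α + β) := by linarith
  subst this
  linear_combination -3 * hp

lemma exists_isRootPair_of_pos {χ τ : ℝ} (hχ : 0 ≤ χ) (hτ : 0 < τ) (h : 0 < channelPoly χ τ) :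
    ∃ p q, IsRootPair χ τ p q := by
  set k := χ / τ with hkdef
  have hk : 0 ≤ k := by positivity
  have hge : ∀ p, 0 ≤ p → p ≤ resolvent k p := fun p hp => by
    rw [resolvent]
    have h1 : 1 ≤ 1 + k ^ 2 / (1 + 3 * p ^ 2) ^ 2 := by
      have : 0 ≤ k ^ 2 / (1 + 3 * p ^ 2) ^ 2 := by positivity
      linarith
    have h2 : p * 1 ≤ p * (1 + p ^ 2) := by gcongr; nlinarith
    nlinarith [mul_le_mul_of_nonneg_left h1 (show 0 ≤ p * (1 + p ^ 2) by positivity)]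
  have hfin : ∀ p, 0 < p → resolvent k p = 2 / τ → k * p < 1 + 3 * p ^ 2 →
      ∃ p q, IsRootPair χ τ p q := fun p h1 h2 h3 =>
    ⟨p, _, (isRootPair_iff hχ hτ).2 ⟨h1, by rw [← hkdef, h2]; field_simp, rfl, h3⟩⟩
  have h0 : resolvent k 0 = 0 := by simp [resolvent]
  by_cases hall : ∀ p, 0 < p → k * p < 1 + 3 * p ^ 2
  · obtain ⟨p, hp, he⟩ : 2 / τ ∈ resolvent k '' Icc 0 (2 / τ) :=
      intermediate_value_Icc (by positivity) (continuous_resolvent k).continuousOn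
        ⟨by rw [h0]; positivity, hge _ (by positivity)⟩
    have hp0 : 0 < p := hp.1.lt_of_ne (by rintro rfl; rw [h0] at he; exact (by positivity : 2 / τ ≠ 0) he.symm)
    exact hfin p hp0 he (hall p hp0)
  · push Not at hall
    obtain ⟨p₀, hp₀, hle⟩ := hall
    obtain ⟨α, β, hα, hαβ, hs, hm⟩ := exists_roots hk hp₀ hle
    have hfac := factor_roots hs hm
    have hβ : 0 < β := hα.trans_le hαβ
    rw [channelPoly_eq hτ.ne' hs hm,
      resolvent_of_root (k := k) hα (by have := hfac α; simp at this; linarith),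
      resolvent_of_root (k := k) hβ (by have := hfac β; simp at this; linarith)] at h
    have h' : 0 < (τ * resolvent k α - 2) * (τ * resolvent k β - 2) := by
      by_contra! hc
      have : 81 * τ ^ 2 * (α * (τ * resolvent k α - 2) * (β * (τ * resolvent k β - 2)))
        = 81 * τ ^ 2 * (α * β) * ((τ * resolvent k α - 2) * (τ * resolvent k β - 2)) := by ring
      rw [this] at h
      exact absurd h (not_lt.2 (mul_nonpos_of_nonneg_of_nonpos (by positivity) hc))
    -- Equal signs at α and β: if both are positive the level 2/τ is attained on (0, α), if both are
    -- negative it is attained beyond β.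
    rcases pos_and_pos_or_neg_and_neg_of_mul_pos h' with ⟨ha, -⟩ | ⟨-, hb⟩
    · have ha' : 2 / τ < resolvent k α := by rw [div_lt_iff₀ hτ]; linarith
      obtain ⟨p, hp, he⟩ : 2 / τ ∈ resolvent k '' Icc 0 α :=
        intermediate_value_Icc hα.le (continuous_resolvent k).continuousOn
          ⟨by rw [h0]; positivity, ha'.le⟩
      have hp0 : 0 < p := hp.1.lt_of_ne (by rintro rfl; rw [h0] at he; exact (by positivity : 2 / τ ≠ 0) he.symm)
      have hpα : p < α := hp.2.lt_of_ne (by rintro rfl; exact ha'.ne' he)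
      refine hfin p hp0 he ?_
      have : 0 < (p - α) * (p - β) := mul_pos_of_neg_of_neg (by linarith) (by linarith)
      linarith [hfac p]
    · have hb' : resolvent k β < 2 / τ := by rw [lt_div_iff₀ hτ]; linarith
      obtain ⟨p, hp, he⟩ : 2 / τ ∈ resolvent k '' Icc β (β + 2 / τ) := by
        have : 0 < 2 / τ := by positivity
        exact intermediate_value_Icc (by linarith) (continuous_resolvent k).continuousOn
          ⟨hb'.le, by linarith [hge (β + 2 / τ) (by positivity)]⟩
      have hpβ : β < p := hp.1.lt_of_ne (by rintro rfl; exact hb'.ne he)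
      refine hfin p (hβ.trans hpβ) he ?_
      have : 0 < (p - α) * (p - β) := mul_pos (by linarith) (by linarith)
      linarith [hfac p]

/-- Two solutions cannot share a monotonicity interval. If instead p < α ≤ β < p', the resolvent
exceeds 2/τ at α and is below it at β, which makes `channelPoly` negative. -/
lemma not_isRootPair_lt {χ τ p q p' q' : ℝ} (hχ : 0 ≤ χ) (hτ : 0 < τ) (h : 0 < channelPoly χ τ)
    (h₁ : IsRootPair χ τ p q) (h₂ : IsRootPair χ τ p' q') : ¬ p < p' := by
  intro hlt
  rw [isRootPair_iff hχ hτ] at h₁ h₂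
  obtain ⟨hp, he, -, ha⟩ := h₁
  obtain ⟨hp', he', -, ha'⟩ := h₂
  set k := χ / τ with hkdef
  have hk : 0 ≤ k := by positivity
  have heq : resolvent k p = resolvent k p' := mul_left_cancel₀ hτ.ne' (he.trans he'.symm)
  by_cases hall : ∀ x ∈ Ioo p p', k * x < 1 + 3 * x ^ 2
  · have := resolvent_strictMonoOn hk (convex_Icc p p')
      (by rw [interior_Icc]; exact fun x hx => hp.trans hx.1) (by rwa [interior_Icc])
      (left_mem_Icc.2 hlt.le) (right_mem_Icc.2 hlt.le) hlt
    exact this.ne heq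
  push Not at hall
  obtain ⟨x, ⟨hx1, hx2⟩, hle⟩ := hall
  obtain ⟨α, β, hα, hαβ, hs, hm⟩ := exists_roots hk (hp.trans hx1) hle
  have hfac := factor_roots hs hm
  have hβ : 0 < β := hα.trans_le hαβ
  have hxα : α ≤ x := by
    by_contra! hc
    have : 0 < (x - α) * (x - β) := mul_pos_of_neg_of_neg (by linarith) (by linarith)
    linarith [hfac x]
  have hxβ : x ≤ β := by
    by_contra! hc
    have : 0 < (x - α) * (x - β) := mul_pos (by linarith) (by linarith)
    linarith [hfac x]
  have hpα : p < α := by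
    by_contra! hc
    have : (p - α) * (p - β) ≤ 0 := mul_nonpos_of_nonneg_of_nonpos (by linarith) (by linarith)
    linarith [hfac p]
  have hpβ : β < p' := by
    by_contra! hc
    have : (p' - α) * (p' - β) ≤ 0 := mul_nonpos_of_nonneg_of_nonpos (by linarith) (by linarith)
    linarith [hfac p']
  have hmα : resolvent k p < resolvent k α := by
    refine resolvent_strictMonoOn hk (convex_Icc p α)
      (by rw [interior_Icc]; exact fun x hx => hp.trans hx.1) ?_
      (left_mem_Icc.2 hpα.le) (right_mem_Icc.2 hpα.le) hpα
    rw [interior_Icc]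
    intro y hy
    have : 0 < (y - α) * (y - β) :=
      mul_pos_of_neg_of_neg (by linarith [hy.2]) (by linarith [hy.2])
    linarith [hfac y]
  have hmβ : resolvent k β < resolvent k p' := by
    refine resolvent_strictMonoOn hk (convex_Icc β p')
      (by rw [interior_Icc]; exact fun x hx => hβ.trans hx.1) ?_
      (left_mem_Icc.2 hpβ.le) (right_mem_Icc.2 hpβ.le) hpβ
    rw [interior_Icc]
    intro y hy
    have : 0 < (y - α) * (y - β) := mul_pos (by linarith [hy.1]) (by linarith [hy.1])
    linarith [hfac y]
  rw [channelPoly_eq hτ.ne' hs hm,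
    resolvent_of_root (k := k) hα (by have := hfac α; simp at this; linarith),
    resolvent_of_root (k := k) hβ (by have := hfac β; simp at this; linarith)] at h
  have h1 : 0 < τ * resolvent k α - 2 := by nlinarith
  have h2 : τ * resolvent k β - 2 < 0 := by nlinarith
  have := mul_neg_of_pos_of_neg (mul_pos hα h1) (mul_neg_of_pos_of_neg hβ h2)
  nlinarith [mul_neg_of_pos_of_neg (show 0 < 81 * τ ^ 2 by positivity) this]

lemma existsUnique_isRootPair {x : ℝ × ℝ} (hx : x ∈ exterior) :
    ∃! w : ℝ × ℝ, IsRootPair x.1 x.2 w.1 w.2 := by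
  have hP := channelPoly_pos hx
  obtain ⟨χ, τ⟩ := x
  obtain ⟨⟨hχ, hτ⟩, -⟩ := hx
  simp only [mem_Ici] at hχ hτ hP ⊢
  rcases hτ.lt_or_eq with hτ | rfl
  · obtain ⟨p, q, h⟩ := exists_isRootPair_of_pos hχ hτ hP
    refine ⟨(p, q), h, fun ⟨p', q'⟩ h' => ?_⟩
    simp only at h'
    have hp : p' = p := le_antisymm (not_lt.1 (not_isRootPair_lt hχ hτ hP h h'))
      (not_lt.1 (not_isRootPair_lt hχ hτ hP h' h))
    rw [isRootPair_iff hχ hτ] at h h'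
    rw [h.2.2.1, h'.2.2.1, hp]
  -- On the axis τ = 0 the quartic is χ³(χ - 2), and the equations degenerate to p = 0, χq = 2.
  · have hχ2 : 2 < χ := by
      by_contra! hc
      have : 0 ≤ χ ^ 3 * (2 - χ) := mul_nonneg (by positivity) (by linarith)
      simp only [channelPoly] at hP
      linarith
    refine ⟨(0, 2 / χ), ⟨?_, by positivity, by simp, by simp; field_simp⟩, fun ⟨p, q⟩ h => ?_⟩
    · simp only
      rw [div_pow, div_lt_one (by positivity)]
      nlinarith
    · obtain ⟨-, h2, h3, h4⟩ := h
      have hp : p = 0 := by simpa using h3.symm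
      simp only [hp] at h2 h4
      have hq : q ≠ 0 := by rintro rfl; simp at h2
      rw [hp, Prod.mk.injEq]
      refine ⟨rfl, ?_⟩
      rw [eq_div_iff (by positivity)]
      refine mul_left_cancel₀ hq ?_
      linear_combination h4

/-! ### Continuous differentiability of the inverse map -/

/-- The values `(p, q)` of the real and imaginary part of `R(i)`, as a function on the exterior. -/
def rootPair (x : ℝ × ℝ) : ℝ × ℝ :=
  Classical.epsilon fun w : ℝ × ℝ => IsRootPair x.1 x.2 w.1 w.2

lemma isRootPair_rootPair {x : ℝ × ℝ} (hx : x ∈ exterior) :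
    IsRootPair x.1 x.2 (rootPair x).1 (rootPair x).2 :=
  Classical.epsilon_spec (p := fun w : ℝ × ℝ => IsRootPair x.1 x.2 w.1 w.2)
    (existsUnique_isRootPair hx).exists

lemma IsRootPair.eq_rootPair {x : ℝ × ℝ} (hx : x ∈ exterior) {p q : ℝ}
    (h : IsRootPair x.1 x.2 p q) : rootPair x = (p, q) :=
  (existsUnique_isRootPair hx).unique (y₂ := (p, q)) (isRootPair_rootPair hx) h

/-- The inverse of `rootPair`. -/
def rootMap (w : ℝ × ℝ) : ℝ × ℝ :=
  (2 * w.2 * (1 + 3 * w.1 ^ 2) / ((1 + w.1 ^ 2) * (w.1 ^ 2 + w.2 ^ 2)),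
    2 * w.1 / ((1 + w.1 ^ 2) * (w.1 ^ 2 + w.2 ^ 2)))

lemma isRootPair_iff_rootMap {x w : ℝ × ℝ} (h1 : w.2 ^ 2 < 1) (h2 : 0 < w.1 ^ 2 + w.2 ^ 2) :
    IsRootPair x.1 x.2 w.1 w.2 ↔ rootMap w = x := by
  have hn : (1 + w.1 ^ 2) * (w.1 ^ 2 + w.2 ^ 2) ≠ 0 := by positivity
  rw [rootMap, Prod.ext_iff, div_eq_iff hn, div_eq_iff hn]
  exact ⟨fun h => ⟨h.chi_eq.symm, h.tau_eq.symm⟩, fun h => ⟨h1, h2, h.2.symm, h.1.symm⟩⟩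

/-- The linear map with matrix `!![a, b; c, d]`. -/
def planeMap (a b c d : ℝ) : ℝ × ℝ →L[ℝ] ℝ × ℝ :=
  (a • ContinuousLinearMap.fst ℝ ℝ ℝ + b • ContinuousLinearMap.snd ℝ ℝ ℝ).prod
    (c • ContinuousLinearMap.fst ℝ ℝ ℝ + d • ContinuousLinearMap.snd ℝ ℝ ℝ)

lemma planeMap_apply (a b c d : ℝ) (v : ℝ × ℝ) :
    planeMap a b c d v = (a * v.1 + b * v.2, c * v.1 + d * v.2) := rfl

/-- The linear equivalence with matrix `!![a, b; c, d]` and inverse `!![a', b'; c', d']`. -/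
def planeEquiv (a b c d a' b' c' d' : ℝ) (h₁ : a * a' + b * c' = 1) (h₂ : a * b' + b * d' = 0)
    (h₃ : c * a' + d * c' = 0) (h₄ : c * b' + d * d' = 1) (h₅ : a' * a + b' * c = 1)
    (h₆ : a' * b + b' * d = 0) (h₇ : c' * a + d' * c = 0) (h₈ : c' * b + d' * d = 1) :
    (ℝ × ℝ) ≃L[ℝ] (ℝ × ℝ) :=
  ContinuousLinearEquiv.equivOfInverse (planeMap a b c d) (planeMap a' b' c' d')
    (fun v => by
      simp only [planeMap_apply]
      ext
      · linear_combination v.1 * h₅ + v.2 * h₆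
      · linear_combination v.1 * h₇ + v.2 * h₈)
    (fun v => by
      simp only [planeMap_apply]
      ext
      · linear_combination v.1 * h₁ + v.2 * h₂
      · linear_combination v.1 * h₃ + v.2 * h₄)

lemma hasFDerivAt_rootMap {w : ℝ × ℝ} (h : 0 < w.1 ^ 2 + w.2 ^ 2) :
    HasFDerivAt rootMap (planeMap
      (4 * w.1 * w.2 * (2 * w.2 ^ 2 - 1 - 2 * w.1 ^ 2 - 3 * w.1 ^ 4) /
        ((1 + w.1 ^ 2) ^ 2 * (w.1 ^ 2 + w.2 ^ 2) ^ 2))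
      (2 * (1 + 3 * w.1 ^ 2) * (w.1 ^ 2 - w.2 ^ 2) / ((1 + w.1 ^ 2) * (w.1 ^ 2 + w.2 ^ 2) ^ 2))
      (2 * (w.2 ^ 2 - w.1 ^ 2 - w.1 ^ 2 * w.2 ^ 2 - 3 * w.1 ^ 4) /
        ((1 + w.1 ^ 2) ^ 2 * (w.1 ^ 2 + w.2 ^ 2) ^ 2))
      (-4 * w.1 * w.2 / ((1 + w.1 ^ 2) * (w.1 ^ 2 + w.2 ^ 2) ^ 2))) w := by
  have hn : (1 + w.1 ^ 2) * (w.1 ^ 2 + w.2 ^ 2) ≠ 0 := by positivity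
  have h1 : HasFDerivAt (fun w : ℝ × ℝ => w.1) (ContinuousLinearMap.fst ℝ ℝ ℝ) w :=
    hasFDerivAt_fst
  have h2 : HasFDerivAt (fun w : ℝ × ℝ => w.2) (ContinuousLinearMap.snd ℝ ℝ ℝ) w :=
    hasFDerivAt_snd
  have hd := ((h1.pow 2).const_add 1).mul ((h1.pow 2).add (h2.pow 2))
  have hi := (hasDerivAt_inv hn).comp_hasFDerivAt_of_eq w hd rfl
  have hχ := ((h2.const_mul 2).mul (((h1.pow 2).const_mul 3).const_add 1)).mul hi
  have hτ := (h1.const_mul 2).mul hi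
  refine (hχ.prodMk hτ).congr_fderiv ?_
  have hn1 : (1 + w.1 ^ 2) ≠ 0 := by positivity
  ext <;> simp [planeMap_apply] <;> field_simp <;> ring

lemma contDiffAt_rootMap {w : ℝ × ℝ} (h : 0 < w.1 ^ 2 + w.2 ^ 2) :
    ContDiffAt ℝ 1 rootMap w := by
  have hn : (1 + w.1 ^ 2) * (w.1 ^ 2 + w.2 ^ 2) ≠ 0 := by positivity
  unfold rootMap
  fun_prop (disch := assumption)

lemma exterior_mem_nhdsWithin {x : ℝ × ℝ} (hx : x ∈ exterior) :
    exterior ∈ 𝓝[Ici 0 ×ˢ Ici 0] x := by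
  have : (closure channels)ᶜ ∈ 𝓝 x := isClosed_closure.isOpen_compl.mem_nhds hx.2
  exact inter_mem_nhdsWithin _ this

/-- `J` in the denominators is the numerator of the Jacobian of `rootMap`. -/
lemma rootPair_local {x : ℝ × ℝ} (hx : x ∈ exterior) {p q J : ℝ} (h : IsRootPair x.1 x.2 p q)
    (hJ : J = q ^ 2 * (1 - 6 * p ^ 2 - 3 * p ^ 4) + p ^ 2 * (1 + 3 * p ^ 2) ^ 2) :
    ContDiffWithinAt ℝ 1 rootPair exterior x ∧
    HasFDerivWithinAt rootPair (planeMap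
      (-(p * q * (1 + p ^ 2) ^ 2 * (p ^ 2 + q ^ 2)) / J)
      (-((1 + 3 * p ^ 2) * (p ^ 2 - q ^ 2) * (1 + p ^ 2) ^ 2 * (p ^ 2 + q ^ 2)) / (2 * J))
      (-((q ^ 2 - p ^ 2 - p ^ 2 * q ^ 2 - 3 * p ^ 4) * (1 + p ^ 2) * (p ^ 2 + q ^ 2)) / (2 * J))
      (p * q * (2 * q ^ 2 - 1 - 2 * p ^ 2 - 3 * p ^ 4) * (1 + p ^ 2) * (p ^ 2 + q ^ 2) / J))
      exterior x := by
  have hpos := h.pos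
  have hJ0 : J ≠ 0 := by
    rw [hJ]
    have := jacobian_pos (sq_nonneg p) (sq_nonneg q) h.sq_lt h.pos
    rw [show (p ^ 2) ^ 2 = p ^ 4 by ring] at this
    exact this.ne'
  have hmap : rootMap (p, q) = x := (isRootPair_iff_rootMap (w := (p, q)) h.sq_lt h.pos).1 h
  have hD := hasFDerivAt_rootMap (w := (p, q)) h.pos
  have hC := contDiffAt_rootMap (w := (p, q)) h.pos
  -- The inverse matrix is written out so that the partial derivatives of p and q are available
  -- explicitly later.
  let e := planeEquiv
    (4 * p * q * (2 * q ^ 2 - 1 - 2 * p ^ 2 - 3 * p ^ 4) / ((1 + p ^ 2) ^ 2 * (p ^ 2 + q ^ 2) ^ 2))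
    (2 * (1 + 3 * p ^ 2) * (p ^ 2 - q ^ 2) / ((1 + p ^ 2) * (p ^ 2 + q ^ 2) ^ 2))
    (2 * (q ^ 2 - p ^ 2 - p ^ 2 * q ^ 2 - 3 * p ^ 4) / ((1 + p ^ 2) ^ 2 * (p ^ 2 + q ^ 2) ^ 2))
    (-4 * p * q / ((1 + p ^ 2) * (p ^ 2 + q ^ 2) ^ 2))
    (-(p * q * (1 + p ^ 2) ^ 2 * (p ^ 2 + q ^ 2)) / J)
    (-((1 + 3 * p ^ 2) * (p ^ 2 - q ^ 2) * (1 + p ^ 2) ^ 2 * (p ^ 2 + q ^ 2)) / (2 * J))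
    (-((q ^ 2 - p ^ 2 - p ^ 2 * q ^ 2 - 3 * p ^ 4) * (1 + p ^ 2) * (p ^ 2 + q ^ 2)) / (2 * J))
    (p * q * (2 * q ^ 2 - 1 - 2 * p ^ 2 - 3 * p ^ 4) * (1 + p ^ 2) * (p ^ 2 + q ^ 2) / J)
    (by field_simp; rw [hJ]; ring) (by field_simp; ring) (by field_simp; ring)
    (by field_simp; rw [hJ]; ring) (by field_simp; rw [hJ]; ring) (by field_simp; ring)
    (by field_simp; ring) (by field_simp; rw [hJ]; ring)
  have hD' : HasFDerivAt rootMap (e : (ℝ × ℝ) →L[ℝ] (ℝ × ℝ)) (p, q) := hD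
  have hS := hC.hasStrictFDerivAt' hD' one_ne_zero
  let G := hS.localInverse rootMap e (p, q)
  have hGC : ContDiffAt ℝ 1 G x := hmap ▸ hC.to_localInverse hD' one_ne_zero
  have hGD : HasFDerivAt G (e.symm : (ℝ × ℝ) →L[ℝ] (ℝ × ℝ)) x :=
    hmap ▸ hS.to_localInverse.hasFDerivAt
  have hG0 : G x = (p, q) := hmap ▸ hS.localInverse_apply_image
  have hinv : ∀ᶠ y in 𝓝 x, rootMap (G y) = y := hmap ▸ hS.eventually_right_inverse
  have hGt : Tendsto G (𝓝 x) (𝓝 (p, q)) := hG0 ▸ hGC.continuousAt.tendsto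
  have hc1 : ContinuousAt (fun w : ℝ × ℝ => w.2 ^ 2) (p, q) := by fun_prop
  have hc2 : ContinuousAt (fun w : ℝ × ℝ => w.1 ^ 2 + w.2 ^ 2) (p, q) := by fun_prop
  -- The conditions q² < 1 and p² + q² > 0 are open, so the local inverse yields root pairs near x,
  -- and global uniqueness identifies them with `rootPair` on the exterior.
  have hev : rootPair =ᶠ[𝓝[exterior] x] G := by
    filter_upwards [self_mem_nhdsWithin, nhdsWithin_le_nhds hinv,
      nhdsWithin_le_nhds (hGt.eventually (hc1.eventually (gt_mem_nhds h.sq_lt))),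
      nhdsWithin_le_nhds (hGt.eventually (hc2.eventually (lt_mem_nhds h.pos)))] with y hy h1 h2 h3
    exact ((isRootPair_iff_rootMap h2 h3).2 h1).eq_rootPair hy
  have hev0 : rootPair x = G x := hG0 ▸ h.eq_rootPair hx
  exact ⟨hGC.contDiffWithinAt.congr_of_eventuallyEq hev hev0,
    (hGD.hasFDerivWithinAt.congr_of_eventuallyEq hev hev0)⟩

lemma contDiffOn_rootPair : ContDiffOn ℝ 1 rootPair exterior := fun _ hx =>
  (rootPair_local hx (isRootPair_rootPair hx) rfl).1

/-- The part of a horizontal line in the exterior is relatively open in the closed half-line. -/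
lemma mem_exterior_chi {χ τ : ℝ} (hx : (χ, τ) ∈ exterior) :
    {s | (s, τ) ∈ exterior} ∈ 𝓝[Ici 0] χ := by
  have hc : ContinuousWithinAt (fun s : ℝ => (s, τ)) (Ici 0) χ := by fun_prop
  exact (hc.tendsto_nhdsWithin (t := Ici 0 ×ˢ Ici 0) fun s hs => ⟨hs, hx.1.2⟩) (exterior_mem_nhdsWithin hx)

/-- The part of a vertical line in the exterior is relatively open in the closed half-line. -/
lemma mem_exterior_tau {χ τ : ℝ} (hx : (χ, τ) ∈ exterior) :
    {t | (χ, t) ∈ exterior} ∈ 𝓝[Ici 0] τ := by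
  have hc : ContinuousWithinAt (fun t : ℝ => (χ, t)) (Ici 0) τ := by fun_prop
  exact (hc.tendsto_nhdsWithin (t := Ici 0 ×ˢ Ici 0) fun t ht => ⟨hx.1.1, ht⟩) (exterior_mem_nhdsWithin hx)

lemma rootPair_chi {χ τ : ℝ} (hx : (χ, τ) ∈ exterior) {p q J : ℝ} (h : IsRootPair χ τ p q)
    (hJ : J = q ^ 2 * (1 - 6 * p ^ 2 - 3 * p ^ 4) + p ^ 2 * (1 + 3 * p ^ 2) ^ 2) :
    HasDerivWithinAt (fun s => (rootPair (s, τ)).1)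
      (-(p * q * (1 + p ^ 2) ^ 2 * (p ^ 2 + q ^ 2)) / J) (Ici 0) χ ∧
    HasDerivWithinAt (fun s => (rootPair (s, τ)).2)
      (-((q ^ 2 - p ^ 2 - p ^ 2 * q ^ 2 - 3 * p ^ 4) * (1 + p ^ 2) * (p ^ 2 + q ^ 2)) / (2 * J))
      (Ici 0) χ := by
  have hd := (rootPair_local hx h hJ).2
  have hl : HasDerivWithinAt (fun s : ℝ => (s, τ)) (1, 0) {s | (s, τ) ∈ exterior} χ :=
    ((hasDerivAt_id' χ).prodMk (hasDerivAt_const χ τ)).hasDerivWithinAt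
  have hc := (hd.comp_hasDerivWithinAt χ hl fun s hs => hs).mono_of_mem_nhdsWithin
    (mem_exterior_chi hx)
  have h1 := hasFDerivAt_fst (𝕜 := ℝ) (p := rootPair (χ, τ)) |>.comp_hasDerivWithinAt χ hc
  have h2 := hasFDerivAt_snd (𝕜 := ℝ) (p := rootPair (χ, τ)) |>.comp_hasDerivWithinAt χ hc
  exact ⟨h1.congr_deriv (by simp [planeMap_apply]), h2.congr_deriv (by simp [planeMap_apply])⟩

lemma rootPair_tau {χ τ : ℝ} (hx : (χ, τ) ∈ exterior) {p q J : ℝ} (h : IsRootPair χ τ p q)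
    (hJ : J = q ^ 2 * (1 - 6 * p ^ 2 - 3 * p ^ 4) + p ^ 2 * (1 + 3 * p ^ 2) ^ 2) :
    HasDerivWithinAt (fun t => (rootPair (χ, t)).1)
      (-((1 + 3 * p ^ 2) * (p ^ 2 - q ^ 2) * (1 + p ^ 2) ^ 2 * (p ^ 2 + q ^ 2)) / (2 * J))
      (Ici 0) τ ∧
    HasDerivWithinAt (fun t => (rootPair (χ, t)).2)
      (p * q * (2 * q ^ 2 - 1 - 2 * p ^ 2 - 3 * p ^ 4) * (1 + p ^ 2) * (p ^ 2 + q ^ 2) / J)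
      (Ici 0) τ := by
  have hd := (rootPair_local hx h hJ).2
  have hl : HasDerivWithinAt (fun t : ℝ => (χ, t)) (0, 1) {t | (χ, t) ∈ exterior} τ :=
    ((hasDerivAt_const τ χ).prodMk (hasDerivAt_id' τ)).hasDerivWithinAt
  have hc := (hd.comp_hasDerivWithinAt τ hl fun t ht => ht).mono_of_mem_nhdsWithin
    (mem_exterior_tau hx)
  have h1 := hasFDerivAt_fst (𝕜 := ℝ) (p := rootPair (χ, τ)) |>.comp_hasDerivWithinAt τ hc
  have h2 := hasFDerivAt_snd (𝕜 := ℝ) (p := rootPair (χ, τ)) |>.comp_hasDerivWithinAt τ hc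
  exact ⟨h1.congr_deriv (by simp [planeMap_apply]), h2.congr_deriv (by simp [planeMap_apply])⟩

/-! ### The phase as a critical value, and the dispersionless system -/

/-- `B² = ρ` as a function of `(p, q)`. -/
def densityOf (p q : ℝ) : ℝ := (1 + p ^ 2) * (1 - q ^ 2)

/-- The phase as a function of `(χ, τ)` and `(p, q)`. -/
def phaseOf (χ τ p q : ℝ) : ℝ :=
  χ * (-(p * q)) + τ * ((p * q) ^ 2 - 1 / 2 * densityOf p q) + 2 * Real.arctan p

/-- The phase is stationary with respect to `(p, q)` at a root pair. -/
lemma IsRootPair.phaseOf_stationary {χ τ p q : ℝ} (h : IsRootPair χ τ p q) :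
    -χ * q + τ * (2 * p * q ^ 2 - p * (1 - q ^ 2)) + 2 * (1 / (1 + p ^ 2)) = 0 ∧
    -χ * p + τ * (2 * p ^ 2 * q + (1 + p ^ 2) * q) = 0 := by
  have hpos := h.pos
  have hn : (1 + p ^ 2) * (p ^ 2 + q ^ 2) ≠ 0 := by positivity
  have hτ := (eq_div_iff hn).2 h.tau_eq
  have hχ := (eq_div_iff hn).2 h.chi_eq
  rw [hτ, hχ]
  constructor <;> field_simp <;> ring

lemma phaseOf_chi {χ τ : ℝ} (hx : (χ, τ) ∈ exterior) :
    HasDerivWithinAt (fun s => phaseOf s τ (rootPair (s, τ)).1 (rootPair (s, τ)).2)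
      (-((rootPair (χ, τ)).1 * (rootPair (χ, τ)).2)) (Ici 0) χ := by
  have h := isRootPair_rootPair hx
  obtain ⟨h1, h2⟩ := rootPair_chi hx h rfl
  obtain ⟨e1, e2⟩ := h.phaseOf_stationary
  have hd := (((hasDerivAt_id' χ).hasDerivWithinAt.fun_mul (h1.fun_mul h2).fun_neg).fun_add
    (((((h1.fun_mul h2).fun_pow 2).fun_sub ((((h1.fun_pow 2).const_add 1).fun_mul
      ((h2.fun_pow 2).const_sub 1)).const_mul (1 / 2))).const_mul τ))).fun_add
      (h1.arctan.const_mul 2)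
  refine hd.congr_deriv ?_
  -- The values of p_χ and q_χ are irrelevant: stationarity makes their coefficients vanish, leaving
  -- only the explicit derivative in χ.
  generalize -((rootPair (χ, τ)).1 * (rootPair (χ, τ)).2 * (1 + (rootPair (χ, τ)).1 ^ 2) ^ 2 *
    _) / _ = p' at *
  generalize -((_ : ℝ) * (1 + (rootPair (χ, τ)).1 ^ 2) * _) / _ = q' at *
  linear_combination p' * e1 + q' * e2

lemma contDiffOn_phaseOf :
    ContDiffOn ℝ 1 (fun x : ℝ × ℝ => phaseOf x.1 x.2 (rootPair x).1 (rootPair x).2) exterior := by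
  have h := contDiffOn_rootPair
  have h1 := h.fst
  have h2 := h.snd
  unfold phaseOf densityOf
  have h3 := Real.contDiff_arctan.comp_contDiffOn (n := 1) h1
  have h4 : ContDiffOn ℝ 1 (fun x : ℝ × ℝ => Real.arctan (rootPair x).1) exterior := h3
  fun_prop

/-- If the density and the phase are given by root pairs, then they are continuously
differentiable and solve the dispersionless Schrödinger system. -/
lemma dispersionless_system
    (hγ : ∀ x ∈ exterior, gamma x.1 x.2 = phaseOf x.1 x.2 (rootPair x).1 (rootPair x).2)
    (hρ : ∀ x ∈ exterior, rho x.1 x.2 = densityOf (rootPair x).1 (rootPair x).2) :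
    ContDiffOn ℝ 1 (fun x : ℝ × ℝ => gamma x.1 x.2) exterior ∧
    ContDiffOn ℝ 1 (fun x : ℝ × ℝ => rho x.1 x.2) exterior ∧
    ContDiffOn ℝ 1 (fun x : ℝ × ℝ => U x.1 x.2) exterior ∧
    ∀ χ τ : ℝ, (χ, τ) ∈ exterior →
      dTau rho χ τ + dChi (fun s t => rho s t * U s t) χ τ = 0 ∧
      dTau U χ τ + dChi (fun s t => 1 / 2 * U s t ^ 2 - rho s t) χ τ = 0 := by
  have hU : ∀ x ∈ exterior, U x.1 x.2 = 2 * ((rootPair x).1 * (rootPair x).2) := by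
    rintro ⟨χ, τ⟩ hx
    have hd : HasDerivWithinAt (fun s => gamma s τ)
        (-((rootPair (χ, τ)).1 * (rootPair (χ, τ)).2)) (Ici 0) χ := by
      refine (phaseOf_chi hx).congr_of_eventuallyEq ?_ (hγ _ hx)
      filter_upwards [mem_exterior_chi hx] with s hs using hγ _ hs
    simp only [U, dChi]
    rw [hd.derivWithin (uniqueDiffOn_Ici 0 χ hx.1.1)]
    ring
  have hC1 := contDiffOn_rootPair.fst
  have hC2 := contDiffOn_rootPair.snd
  refine ⟨contDiffOn_phaseOf.congr hγ, ?_, ?_, fun χ τ hx => ?_⟩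
  · refine ContDiffOn.congr ?_ hρ
    unfold densityOf
    fun_prop
  · refine ContDiffOn.congr ?_ hU
    fun_prop
  have h := isRootPair_rootPair hx
  have hJ0 := jacobian_pos (sq_nonneg (rootPair (χ, τ)).1) (sq_nonneg (rootPair (χ, τ)).2)
    h.sq_lt h.pos
  obtain ⟨p1, q1⟩ := rootPair_chi hx h rfl
  obtain ⟨p2, q2⟩ := rootPair_tau hx h rfl
  have hJ1 : (rootPair (χ, τ)).2 ^ 2 * (1 - 6 * (rootPair (χ, τ)).1 ^ 2
      - 3 * (rootPair (χ, τ)).1 ^ 4)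
      + (rootPair (χ, τ)).1 ^ 2 * (1 + 3 * (rootPair (χ, τ)).1 ^ 2) ^ 2 ≠ 0 := by
    rw [show (rootPair (χ, τ)).1 ^ 4 = ((rootPair (χ, τ)).1 ^ 2) ^ 2 by ring]
    exact hJ0.ne'
  have ρ1 : HasDerivWithinAt (fun t => rho χ t) _ (Ici 0) τ :=
    ((((p2.fun_pow 2).const_add 1).fun_mul ((q2.fun_pow 2).const_sub 1))).congr_of_eventuallyEq
      (by filter_upwards [mem_exterior_tau hx] with s hs using hρ _ hs) (hρ _ hx)
  have ρU : HasDerivWithinAt (fun s => rho s τ * U s τ) _ (Ici 0) χ :=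
    ((((p1.fun_pow 2).const_add 1).fun_mul ((q1.fun_pow 2).const_sub 1)).fun_mul
      ((p1.fun_mul q1).const_mul 2)).congr_of_eventuallyEq
      (by filter_upwards [mem_exterior_chi hx] with s hs using
            congrArg₂ (· * ·) (hρ _ hs) (hU _ hs)) (congrArg₂ (· * ·) (hρ _ hx) (hU _ hx))
  have U1 : HasDerivWithinAt (fun t => U χ t) _ (Ici 0) τ :=
    ((p2.fun_mul q2).const_mul 2).congr_of_eventuallyEq
      (by filter_upwards [mem_exterior_tau hx] with s hs using hU _ hs) (hU _ hx)
  have UU : HasDerivWithinAt (fun s => 1 / 2 * U s τ ^ 2 - rho s τ) _ (Ici 0) χ :=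
    (((((p1.fun_mul q1).const_mul 2).fun_pow 2).const_mul (1 / 2)).fun_sub
      (((p1.fun_pow 2).const_add 1).fun_mul ((q1.fun_pow 2).const_sub 1))).congr_of_eventuallyEq
      (by filter_upwards [mem_exterior_chi hx] with s hs using
            congrArg₂ (fun a b => 1 / 2 * a ^ 2 - b) (hU _ hs) (hρ _ hs))
      (congrArg₂ (fun a b => 1 / 2 * a ^ 2 - b) (hU _ hx) (hρ _ hx))
  have u1 := uniqueDiffOn_Ici (0 : ℝ) χ hx.1.1
  have u2 := uniqueDiffOn_Ici (0 : ℝ) τ hx.1.2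
  simp only [dTau, dChi]
  rw [ρ1.derivWithin u2, ρU.derivWithin u1, U1.derivWithin u2, UU.derivWithin u1]
  generalize (rootPair (χ, τ)).1 = p at *
  generalize (rootPair (χ, τ)).2 = q at *
  -- Both equations are now rational identities in p and q alone, with powers of the nonzero
  -- Jacobian numerator as denominators.
  constructor
  · field_simp
    ring
  · field_simp
    ring

/-! ### From expansion and residues to the equations for p and q -/

lemma IsBranchCut.isCompact {A B : ℝ} {S : Set ℂ} (h : IsBranchCut A B S) : IsCompact S := by
  obtain ⟨⟨c, hc, -, -, -, rfl⟩, -⟩ := h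
  exact isCompact_Icc.image_of_continuousOn hc

lemma IsRootFunction.continuousAt {A B : ℝ} {S : Set ℂ} {R : ℂ → ℂ} (h : IsRootFunction A B S R)
    (hS : IsCompact S) {z : ℂ} (hz : z ∉ S) : ContinuousAt R z :=
  (h.1.differentiableAt (hS.isClosed.isOpen_compl.mem_nhds hz)).continuousAt

/-- The expansion `R(z) = z - A + B² / (2 z) + A B² / (2 z²) + o(z⁻²)`. -/
lemma IsRootFunction.asymptotics {A B : ℝ} {S : Set ℂ} {R : ℂ → ℂ} (h : IsRootFunction A B S R)
    (hS : IsCompact S) :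
    Tendsto (fun z => R z - (z - A)) (cobounded ℂ) (𝓝 0) ∧
    Tendsto (fun z => z * (R z - (z - A))) (cobounded ℂ) (𝓝 ((B : ℂ) ^ 2 / 2)) ∧
    Tendsto (fun z => z * (z * (R z - (z - A)) - (B : ℂ) ^ 2 / 2)) (cobounded ℂ)
      (𝓝 ((A : ℂ) * (B : ℂ) ^ 2 / 2)) := by
  obtain ⟨-, hsq, hO⟩ := h
  have hS' : ∀ᶠ z in cobounded ℂ, z ∉ S := isBounded_def.1 hS.isBounded
  have hz0 : ∀ᶠ z : ℂ in cobounded ℂ, z ≠ 0 := eventually_ne_cobounded 0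
  have hinv : Tendsto (fun z : ℂ => z⁻¹) (cobounded ℂ) (𝓝 0) := tendsto_inv₀_cobounded
  set e : ℂ → ℂ := fun z => R z - (z - A) with hedef
  have he : e =O[cobounded ℂ] (fun _ => (1 : ℂ)) := by
    have : e = fun z => (R z - z) + A := by ext z; simp only [hedef]; ring
    rw [this]
    exact hO.add (isBigO_const_const _ one_ne_zero _)
  have hez : Tendsto (fun z => e z * z⁻¹) (cobounded ℂ) (𝓝 0) :=
    (he.mul (isBigO_refl (fun z : ℂ => z⁻¹) _)).trans_tendsto (by simpa using hinv)
  have hD : Tendsto (fun z => 2 - 2 * A * z⁻¹ + e z * z⁻¹) (cobounded ℂ) (𝓝 2) := by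
    simpa using (tendsto_const_nhds.sub (hinv.const_mul (2 * (A : ℂ)))).add hez
  have hD0 := hD.eventually_ne (two_ne_zero (α := ℂ))
  -- With e = R - (z - A), the relation e(e + 2(z - A)) = B² gives ze = B²/(2 - 2A/z + e/z). This
  -- upgrades boundedness of e to its first coefficient, and a second use gives the next one.
  have hze : (fun z => (B : ℂ) ^ 2 / (2 - 2 * A * z⁻¹ + e z * z⁻¹)) =ᶠ[cobounded ℂ]
      fun z => z * e z := by
    filter_upwards [hS', hz0, hD0] with z h1 h2 h3
    rw [div_eq_iff h3]
    have := hsq z h1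
    simp only [hedef]
    field_simp
    linear_combination -this
  have h1 : Tendsto (fun z => z * e z) (cobounded ℂ) (𝓝 ((B : ℂ) ^ 2 / 2)) :=
    (tendsto_const_nhds.div hD two_ne_zero).congr' hze
  have h0 : Tendsto e (cobounded ℂ) (𝓝 0) := by
    have := hinv.mul h1
    rw [zero_mul] at this
    refine this.congr' ?_
    filter_upwards [hz0] with z hz
    field_simp
  refine ⟨h0, h1, ?_⟩
  have h2 : Tendsto (fun z => (B : ℂ) ^ 2 * (2 * A - e z) / (2 * (2 - 2 * A * z⁻¹ + e z * z⁻¹)))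
      (cobounded ℂ) (𝓝 ((B : ℂ) ^ 2 * (2 * A - 0) / (2 * 2))) :=
    ((h0.const_sub (2 * (A : ℂ))).const_mul _).div (hD.const_mul 2) (by norm_num)
  have e2 : (B : ℂ) ^ 2 * (2 * A - 0) / (2 * 2) = (A : ℂ) * (B : ℂ) ^ 2 / 2 := by ring
  rw [e2] at h2
  refine h2.congr' ?_
  filter_upwards [hze, hz0, hD0] with z h1 h2 h3
  rw [← h1]
  have h5 : 2 - 2 * A * z⁻¹ + e z * z⁻¹ = (2 * (z - A) + e z) / z := by field_simp
  have h4 : 2 * (z - A) + e z ≠ 0 := by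
    intro h
    rw [h5, h, zero_div] at h3
    exact h3 rfl
  rw [h5]
  field_simp
  ring

lemma eventually_sq_add_one_ne : ∀ᶠ z : ℂ in cobounded ℂ, z ^ 2 + 1 ≠ 0 := by
  filter_upwards [eventually_ne_cobounded Complex.I, eventually_ne_cobounded (-Complex.I)]
    with z h1 h2 h
  have : (z - Complex.I) * (z + Complex.I) = 0 := by
    linear_combination h - Complex.I_sq
  rcases mul_eq_zero.1 this with h | h
  · exact h1 (sub_eq_zero.1 h)
  · exact h2 (eq_neg_of_add_eq_zero_left h)

/-- Multiplied by z² + 1, the error becomes αz² + βz + M(z) with M convergent at infinity, so it is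
O(z⁻²) exactly when α = β = 0. -/
lemma IsRootFunction.expansion_iff {A B : ℝ} {S : Set ℂ} {R : ℂ → ℂ}
    (h : IsRootFunction A B S R) (hS : IsCompact S) (χ τ u v : ℝ) :
    (fun z => hDeriv τ u v R z - (2 * τ * z + χ)) =O[cobounded ℂ] (fun z => (z ^ 2)⁻¹) ↔
      u = χ + 2 * τ * A ∧ v = 2 * τ + u * A - τ * B ^ 2 := by
  obtain ⟨h0, h1, h2⟩ := h.asymptotics hS
  set e : ℂ → ℂ := fun z => R z - (z - A) with hedef
  have hz0 : ∀ᶠ z : ℂ in cobounded ℂ, z ≠ 0 := eventually_ne_cobounded 0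
  have hinv : Tendsto (fun z : ℂ => z⁻¹) (cobounded ℂ) (𝓝 0) := tendsto_inv₀_cobounded
  have hinv2 : Tendsto (fun z : ℂ => (z ^ 2)⁻¹) (cobounded ℂ) (𝓝 0) := by
    simpa using hinv.pow 2
  set α : ℝ := u - 2 * τ * A - χ
  set β : ℝ := v - u * A - 2 * τ + τ * B ^ 2
  set M : ℂ → ℂ := fun z => 2 * τ * (z * (z * e z - (B : ℂ) ^ 2 / 2)) + u * (z * e z)
    + v * (e z - A) - χ with hM
  have hMt := (((h2.const_mul (2 * (τ : ℂ))).add (h1.const_mul (u : ℂ))).add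
    ((h0.sub_const (A : ℂ)).const_mul (v : ℂ))).sub_const (χ : ℂ)
  set m := 2 * (τ : ℂ) * ((A : ℂ) * (B : ℂ) ^ 2 / 2) + u * ((B : ℂ) ^ 2 / 2) + v * (0 - A) - χ
  have hMt : Tendsto M (cobounded ℂ) (𝓝 m) := hMt
  have key : ∀ z, z ^ 2 + 1 ≠ 0 → (z ^ 2 + 1) * (hDeriv τ u v R z - (2 * τ * z + χ))
      = α * z ^ 2 + β * z + M z := by
    intro z hz
    simp only [hDeriv, hM, hedef, α, β]
    push_cast
    field_simp
    ring
  have hab : (u = χ + 2 * τ * A ∧ v = 2 * τ + u * A - τ * B ^ 2) ↔ α = 0 ∧ β = 0 := by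
    simp only [α, β]
    constructor
    · rintro ⟨h1, h2⟩; constructor <;> linarith
    · rintro ⟨h1, h2⟩; constructor <;> linarith
  rw [hab]
  have hone : Tendsto (fun z : ℂ => 1 + (z ^ 2)⁻¹) (cobounded ℂ) (𝓝 1) := by
    simpa using hinv2.const_add 1
  constructor
  · intro hO
    have hα : α = 0 := by
      have l1 : Tendsto (fun z : ℂ => α + β * z⁻¹ + M z * (z ^ 2)⁻¹) (cobounded ℂ) (𝓝 (α : ℂ)) := by
        simpa using ((hinv.const_mul (β : ℂ)).const_add (α : ℂ)).add (hMt.mul hinv2)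
      have l2 := hone.mul (hO.trans_tendsto hinv2)
      rw [mul_zero] at l2
      have := tendsto_nhds_unique_of_eventuallyEq l1 l2 (by
        filter_upwards [hz0, eventually_sq_add_one_ne] with z hz hz1
        have := key z hz1
        field_simp
        linear_combination -this)
      exact_mod_cast this
    refine ⟨hα, ?_⟩
    have l1 : Tendsto (fun z : ℂ => β + M z * z⁻¹) (cobounded ℂ) (𝓝 (β : ℂ)) := by
      simpa using (hMt.mul hinv).const_add (β : ℂ)
    have hO' := ((isBigO_refl (fun z : ℂ => z) (cobounded ℂ)).mul hO).trans_tendsto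
      (hinv.congr' (by filter_upwards [hz0] with z hz; field_simp))
    have l2 := hone.mul hO'
    rw [mul_zero] at l2
    have := tendsto_nhds_unique_of_eventuallyEq l1 l2 (by
      filter_upwards [hz0, eventually_sq_add_one_ne] with z hz hz1
      have := key z hz1
      rw [hα] at this
      push_cast at this
      field_simp
      linear_combination -this)
    exact_mod_cast this
  · rintro ⟨hα, hβ⟩
    have l : Tendsto (fun z => M z * (1 + (z ^ 2)⁻¹)⁻¹) (cobounded ℂ) (𝓝 (m * 1⁻¹)) :=
      hMt.mul (hone.inv₀ one_ne_zero)
    have hO := (l.isBigO_one ℂ).mul (isBigO_refl (fun z : ℂ => (z ^ 2)⁻¹) (cobounded ℂ))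
    refine hO.congr' ?_ (by simp)
    filter_upwards [hz0, eventually_sq_add_one_ne] with z hz hz1
    have := key z hz1
    rw [hα, hβ] at this
    push_cast at this
    have h3 : 1 + (z ^ 2)⁻¹ = (z ^ 2 + 1) / z ^ 2 := by field_simp
    rw [h3]
    field_simp
    linear_combination -this

lemma residue_upper_iff {R : ℂ → ℂ} (hR : ContinuousAt R Complex.I) (τ u v : ℝ) :
    Tendsto (fun z => (z - Complex.I) * hDeriv τ u v R z) (𝓝[≠] Complex.I) (𝓝 Complex.I) ↔
      (v - 2 * τ + u * Complex.I) * R Complex.I = -2 := by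
  have hI : Complex.I + Complex.I ≠ 0 := by
    rw [← two_mul]; exact mul_ne_zero two_ne_zero Complex.I_ne_zero
  have hc : ContinuousAt (fun z : ℂ => (2 * τ * z ^ 2 + u * z + v) / (z + Complex.I) * R z)
      Complex.I := by
    fun_prop (disch := assumption)
  have ht : Tendsto (fun z => (z - Complex.I) * hDeriv τ u v R z) (𝓝[≠] Complex.I)
      (𝓝 ((2 * τ * Complex.I ^ 2 + u * Complex.I + v) / (Complex.I + Complex.I)
        * R Complex.I)) := by
    refine (hc.tendsto.mono_left nhdsWithin_le_nhds).congr' ?_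
    have hne : ∀ᶠ z in 𝓝[≠] Complex.I, z + Complex.I ≠ 0 :=
      nhdsWithin_le_nhds ((by fun_prop : ContinuousAt (fun z : ℂ => z + Complex.I)
        Complex.I).eventually_ne hI)
    filter_upwards [self_mem_nhdsWithin, hne] with z h1 h2
    have h1 : z - Complex.I ≠ 0 := sub_ne_zero.2 h1
    rw [hDeriv, show z ^ 2 + 1 = (z - Complex.I) * (z + Complex.I) by
      linear_combination Complex.I_sq]
    field_simp
  have e : (2 * τ * Complex.I ^ 2 + u * Complex.I + v) / (Complex.I + Complex.I) * R Complex.I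
      = Complex.I ↔ (v - 2 * τ + u * Complex.I) * R Complex.I = -2 := by
    rw [div_mul_eq_mul_div, div_eq_iff hI, ← two_mul, mul_left_comm, Complex.I_mul_I, Complex.I_sq]
    constructor <;> intro h <;> linear_combination h
  rw [← e]
  exact ⟨fun h => tendsto_nhds_unique ht h, fun h => by rwa [h] at ht⟩

lemma residue_lower_iff {R : ℂ → ℂ} (hR : ContinuousAt R (-Complex.I)) (τ u v : ℝ) :
    Tendsto (fun z => (z + Complex.I) * hDeriv τ u v R z) (𝓝[≠] (-Complex.I))
      (𝓝 (-Complex.I)) ↔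
      (v - 2 * τ - u * Complex.I) * R (-Complex.I) = -2 := by
  have hI : -Complex.I - Complex.I ≠ 0 := by
    rw [← neg_add', neg_ne_zero, ← two_mul]; exact mul_ne_zero two_ne_zero Complex.I_ne_zero
  have hc : ContinuousAt (fun z : ℂ => (2 * τ * z ^ 2 + u * z + v) / (z - Complex.I) * R z)
      (-Complex.I) := by
    fun_prop (disch := assumption)
  have ht : Tendsto (fun z => (z + Complex.I) * hDeriv τ u v R z) (𝓝[≠] (-Complex.I))
      (𝓝 ((2 * τ * (-Complex.I) ^ 2 + u * (-Complex.I) + v) / (-Complex.I - Complex.I)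
        * R (-Complex.I))) := by
    refine (hc.tendsto.mono_left nhdsWithin_le_nhds).congr' ?_
    have hne : ∀ᶠ z in 𝓝[≠] (-Complex.I), z - Complex.I ≠ 0 :=
      nhdsWithin_le_nhds ((by fun_prop : ContinuousAt (fun z : ℂ => z - Complex.I)
        (-Complex.I)).eventually_ne hI)
    filter_upwards [self_mem_nhdsWithin, hne] with z h1 h2
    have h1 : z + Complex.I ≠ 0 := fun h => h1 (eq_neg_of_add_eq_zero_left h)
    rw [hDeriv, show z ^ 2 + 1 = (z - Complex.I) * (z + Complex.I) by
      linear_combination Complex.I_sq]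
    field_simp
  have e : (2 * τ * (-Complex.I) ^ 2 + u * (-Complex.I) + v) / (-Complex.I - Complex.I)
      * R (-Complex.I) = -Complex.I ↔ (v - 2 * τ - u * Complex.I) * R (-Complex.I) = -2 := by
    rw [div_mul_eq_mul_div, div_eq_iff hI, neg_sq, Complex.I_sq,
      show -Complex.I * (-Complex.I - Complex.I) = -2 by linear_combination 2 * Complex.I_sq]
    constructor <;> intro h <;> linear_combination h
  rw [← e]
  exact ⟨fun h => tendsto_nhds_unique ht h, fun h => by rwa [h] at ht⟩

lemma isGenusZero_iff {χ τ A B u v : ℝ} {S : Set ℂ} {R : ℂ → ℂ} (hB : 0 < B)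
    (hS : IsBranchCut A B S) (hR : IsRootFunction A B S R) :
    IsGenusZero χ τ A B u v S R ↔ (u = χ + 2 * τ * A ∧ v = 2 * τ + u * A - τ * B ^ 2) ∧
      (v - 2 * τ + u * Complex.I) * R Complex.I = -2 ∧
      (v - 2 * τ - u * Complex.I) * R (-Complex.I) = -2 := by
  rw [← hR.expansion_iff hS.isCompact,
    ← residue_upper_iff (hR.continuousAt hS.isCompact hS.2.2.1),
    ← residue_lower_iff (hR.continuousAt hS.isCompact hS.2.2.2)]
  exact ⟨fun h => ⟨h.expansion, h.residue_upper, h.residue_lower⟩,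
    fun h => ⟨hB, hS, hR, h.2.1, h.2.2, h.1⟩⟩

/-- The conditions on a genus-zero modified phase in terms of `R(i) = p + iq`. -/
lemma IsGenusZero.isRootPair {χ τ A B u v : ℝ} {S : Set ℂ} {R : ℂ → ℂ}
    (h : IsGenusZero χ τ A B u v S R) :
    ∃ p q : ℝ, IsRootPair χ τ p q ∧ A = -(p * q) ∧ B ^ 2 = densityOf p q ∧
      R Complex.I = p + q * Complex.I ∧ R (-Complex.I) = p - q * Complex.I := by
  have hB := h.pos
  have hsq := h.root.2.1 Complex.I h.cut.2.2.1
  obtain ⟨⟨hu, hv⟩, h1, h2⟩ := (isGenusZero_iff h.pos h.cut h.root).1 h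
  have e1 := congrArg Complex.re h1
  have e2 := congrArg Complex.im h1
  have e3 := congrArg Complex.re h2
  have e4 := congrArg Complex.im h2
  have e5 := congrArg Complex.re hsq
  have e6 := congrArg Complex.im hsq
  simp [pow_two] at e1 e2 e3 e4 e5 e6
  obtain ⟨p, hp⟩ : ∃ p, p = (R Complex.I).re := ⟨_, rfl⟩
  obtain ⟨q, hq⟩ : ∃ q, q = (R Complex.I).im := ⟨_, rfl⟩
  obtain ⟨p', hp'⟩ : ∃ p, p = (R (-Complex.I)).re := ⟨_, rfl⟩
  obtain ⟨q', hq'⟩ : ∃ q, q = (R (-Complex.I)).im := ⟨_, rfl⟩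
  rw [← hp, ← hq] at e1 e2 e5 e6
  rw [← hp', ← hq'] at e3 e4
  have hA : A = -(p * q) := by linarith
  have hB2 : B ^ 2 = densityOf p q := by rw [densityOf]; rw [hA] at e5; linarith
  set w := v - 2 * τ with hw
  have hn : 0 < p ^ 2 + q ^ 2 := by
    by_contra! hc
    have hp0 : p = 0 := by nlinarith
    have hq0 : q = 0 := by nlinarith
    rw [hp0, hq0] at e1
    norm_num at e1
  have hw' : w * (p ^ 2 + q ^ 2) = -2 * p := by linear_combination p * e1 + q * e2
  have hu' : u * (p ^ 2 + q ^ 2) = 2 * q := by linear_combination p * e2 - q * e1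
  have hq2 : q ^ 2 < 1 := by
    have : 0 < B ^ 2 := by positivity
    rw [hB2, densityOf] at this
    have := pos_of_mul_pos_right this (by positivity)
    linarith
  have hwv : w = u * A - τ * B ^ 2 := by linarith
  -- The relation for τ appears with the extra factor 1 - q², which is nonzero because B > 0.
  have hτ : τ * ((1 + p ^ 2) * (p ^ 2 + q ^ 2)) = 2 * p := by
    refine mul_left_cancel₀ (sub_pos.2 hq2).ne' ?_
    rw [hB2, densityOf, hA] at hwv
    linear_combination hw' * (-1) + (p ^ 2 + q ^ 2) * hwv - p * q * hu'
  refine ⟨p, q, ⟨hq2, hn, hτ, ?_⟩, hA, hB2, ?_, ?_⟩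
  · rw [hA] at hu
    linear_combination (-(1 + p ^ 2) * (p ^ 2 + q ^ 2)) * hu + (1 + p ^ 2) * hu' + 2 * p * q * hτ
  · apply Complex.ext <;> simp [hp, hq]
  -- As u and v are real, the residue equation at -i is the conjugate of the one at i with R(-i) in
  -- place of conj R(i). This gives R(-i) = conj R(i) without a symmetry argument for R.
  · have hne : w ^ 2 + u ^ 2 ≠ 0 := by
      intro hc
      have hw0 : w = 0 := by
        rw [← sq_eq_zero_iff]
        exact le_antisymm (by linarith [sq_nonneg u]) (sq_nonneg w)
      have hu0 : u = 0 := by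
        rw [← sq_eq_zero_iff]
        exact le_antisymm (by linarith [sq_nonneg w]) (sq_nonneg u)
      rw [hw0, hu0] at e1
      norm_num at e1
    apply Complex.ext <;> simp [← hp', ← hq']
    · refine mul_left_cancel₀ hne ?_
      linear_combination w * e3 - u * e4 - w * e1 - u * e2
    · refine mul_left_cancel₀ hne ?_
      linear_combination w * e4 + u * e3 + w * e2 - u * e1

lemma IsRootPair.isGenusZero {χ τ B p q : ℝ} {S : Set ℂ} {R : ℂ → ℂ} (h : IsRootPair χ τ p q)
    (hB : 0 < B) (hB2 : B ^ 2 = densityOf p q) (hS : IsBranchCut (-(p * q)) B S)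
    (hR : IsRootFunction (-(p * q)) B S R) (h1 : R Complex.I = p + q * Complex.I)
    (h2 : R (-Complex.I) = p - q * Complex.I) :
    ∃ u v, IsGenusZero χ τ (-(p * q)) B u v S R := by
  have hpos := h.pos
  have hn : (1 + p ^ 2) * (p ^ 2 + q ^ 2) ≠ 0 := by positivity
  have hτ := (eq_div_iff hn).2 h.tau_eq
  have hχ := (eq_div_iff hn).2 h.chi_eq
  have hu : 2 * q / (p ^ 2 + q ^ 2) = χ + 2 * τ * (-(p * q)) := by
    rw [hτ, hχ]; field_simp; ring
  have hv : 2 * τ - 2 * p / (p ^ 2 + q ^ 2)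
      = 2 * τ + (2 * q / (p ^ 2 + q ^ 2)) * (-(p * q)) - τ * B ^ 2 := by
    rw [hτ, hB2, densityOf]; field_simp; ring
  have hc : (p : ℂ) ^ 2 + q ^ 2 ≠ 0 := by exact_mod_cast hpos.ne'
  refine ⟨_, _, (isGenusZero_iff hB hS hR).2 ⟨⟨hu, hv⟩, ?_, ?_⟩⟩
  · rw [h1]
    push_cast
    field_simp
    linear_combination ((q : ℂ) ^ 2) * Complex.I_sq
  · rw [h2]
    push_cast
    field_simp
    linear_combination ((q : ℂ) ^ 2) * Complex.I_sq

/-! ### Evaluating the phase integrals by a logarithm -/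

/-- The Joukowski-type map `z ↦ z - A + R(z)` takes non-real values off the real line. -/
lemma add_root_im_ne_zero {A B : ℝ} (hB : B ≠ 0) {z r : ℂ} (h : r ^ 2 = (z - A) ^ 2 + (B : ℂ) ^ 2)
    (hz : z.im ≠ 0) : (z - A + r).im ≠ 0 := by
  intro h0
  -- The two factors have a nonzero real product, so if one were real both would be, and so would
  -- their sum 2(z - A).
  have h1 : (z - A + r) * (z - A - r) = ((-B ^ 2 : ℝ) : ℂ) := by
    push_cast; linear_combination -h
  have e1 := congrArg Complex.re h1
  have e2 := congrArg Complex.im h1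
  rw [Complex.mul_re, h0, Complex.ofReal_re, zero_mul, sub_zero] at e1
  rw [Complex.mul_im, h0, Complex.ofReal_im, zero_mul, add_zero] at e2
  rcases mul_eq_zero.1 e2 with h2 | h2
  · rw [h2, zero_mul] at e1
    exact hB (by simpa using e1.symm)
  · have : (z - A + r).im + (z - A - r).im = 2 * z.im := by simp; ring
    rw [h0, h2] at this
    exact hz (by linarith)

/-- `1 / R` is the derivative of the logarithm of `z - A + R(z)`. -/
lemma IsRootFunction.hasDerivAt {A B : ℝ} {S : Set ℂ} {R : ℂ → ℂ} (h : IsRootFunction A B S R)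
    (hS : IsCompact S) (hB : B ≠ 0) {z : ℂ} (hz : z ∉ S) :
    ∃ R', HasDerivAt R R' z ∧ (1 + R') / (z - A + R z) = (R z)⁻¹ := by
  obtain ⟨hd, hsq, -⟩ := h
  have hmem := hS.isClosed.isOpen_compl.mem_nhds hz
  have hR := (hd.differentiableAt hmem).hasDerivAt
  refine ⟨_, hR, ?_⟩
  have h1 := hR.fun_pow 2
  have h2 : HasDerivAt (fun z : ℂ => (z - A) ^ 2 + (B : ℂ) ^ 2) (2 * (z - A)) z := by
    simpa using (((hasDerivAt_id' z).sub_const (A : ℂ)).fun_pow 2).add_const ((B : ℂ) ^ 2)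
  have h3 := h1.unique (h2.congr_of_eventuallyEq (by filter_upwards [hmem] with w hw using hsq w hw))
  simp only [Nat.cast_ofNat, Nat.add_one_sub_one, pow_one] at h3
  have h4 : R z * deriv R z = z - A := by linear_combination h3 / 2
  have hBc : (B : ℂ) ^ 2 ≠ 0 := by simpa using hB
  have hR0 : R z ≠ 0 := by
    intro h0
    have := hsq z hz
    rw [← h4, h0] at this
    apply hBc
    linear_combination -this
  have hW : z - A + R z ≠ 0 := by
    intro h0
    apply hBc
    linear_combination (R z - (z - A)) * h0 - hsq z hz
  rw [div_eq_iff hW, eq_inv_mul_iff_mul_eq₀ hR0]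
  linear_combination h4

/-- Off the real axis z - A + R(z) is non-real, so the principal logarithm is a primitive along the
whole open path whatever its shape. One-sided limits suffice at the ends, where the path may reach a
branch point. -/
lemma IsPath.pathIntegral_eq {A B : ℝ} {H S : Set ℂ} {R : ℂ → ℂ} {a b : ℂ} {p : ℝ → ℂ}
    (hp : IsPath H S R a b p) (hR : IsRootFunction A B S R) (hS : IsCompact S) (hB : B ≠ 0)
    (hH : ∀ z ∈ H, z.im ≠ 0) {l₀ l₁ : ℂ}
    (h₀ : Tendsto (fun t => p t - A + R (p t)) (𝓝[>] 0) (𝓝 l₀))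
    (h₁ : Tendsto (fun t => p t - A + R (p t)) (𝓝[<] 1) (𝓝 l₁))
    (hl₀ : l₀ ∈ Complex.slitPlane) (hl₁ : l₁ ∈ Complex.slitPlane) :
    pathIntegral R p = Complex.log l₁ - Complex.log l₀ := by
  refine intervalIntegral.integral_eq_sub_of_hasDerivAt_of_tendsto
    (f := fun t => Complex.log (p t - A + R (p t))) one_pos (fun t ht => ?_) hp.integrable
    (h₀.clog hl₀) (h₁.clog hl₁)
  have hz := hp.notMem t ht
  have hpd := (hp.differentiableOn.differentiableAt (Ioo_mem_nhds ht.1 ht.2)).hasDerivAt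
  obtain ⟨R', hR', he⟩ := hR.hasDerivAt hS hB hz
  have hc : HasDerivAt (fun t => R (p t)) (R' * deriv p t) t :=
    (hR'.scomp t hpd).congr_deriv (by simp [mul_comm])
  refine (((hpd.sub_const (A : ℂ)).fun_add hc).clog_real (Or.inr ?_)).congr_deriv ?_
  · exact add_root_im_ne_zero hB (hR.2.1 _ hz) (hH _ (hp.mem t ⟨ht.1.le, ht.2.le⟩))
  · rw [div_eq_mul_inv (deriv p t), ← he]
    ring

lemma IsPath.tendsto_source {H S : Set ℂ} {R : ℂ → ℂ} {a b : ℂ} {p : ℝ → ℂ}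
    (hp : IsPath H S R a b p) : Tendsto p (𝓝[>] 0) (𝓝 a) := by
  have h : Tendsto p (𝓝[Icc 0 1] 0) (𝓝 (p 0)) := hp.continuousOn 0 (left_mem_Icc.2 zero_le_one)
  rw [hp.source] at h
  exact h.mono_left (nhdsWithin_le_of_mem (Icc_mem_nhdsGT one_pos))

lemma IsPath.tendsto_target {H S : Set ℂ} {R : ℂ → ℂ} {a b : ℂ} {p : ℝ → ℂ}
    (hp : IsPath H S R a b p) : Tendsto p (𝓝[<] 1) (𝓝 b) := by
  have h : Tendsto p (𝓝[Icc 0 1] 1) (𝓝 (p 1)) := hp.continuousOn 1 (right_mem_Icc.2 zero_le_one)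
  rw [hp.target] at h
  exact h.mono_left (nhdsWithin_le_of_mem (Icc_mem_nhdsLT one_pos))

/-- At a branch point `e` the function `z - A + R(z)` tends to `e - A`. -/
lemma IsRootFunction.tendsto_branch {A B : ℝ} {S : Set ℂ} {R : ℂ → ℂ}
    (h : IsRootFunction A B S R) {l : Filter ℝ} {p : ℝ → ℂ} {e : ℂ} (hp : Tendsto p l (𝓝 e))
    (hpS : ∀ᶠ t in l, p t ∉ S) (he : (e - A) ^ 2 + (B : ℂ) ^ 2 = 0) :
    Tendsto (fun t => p t - A + R (p t)) l (𝓝 (e - A)) := by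
  have h1 : Tendsto (fun t => (p t - A) ^ 2 + (B : ℂ) ^ 2) l (𝓝 0) := by
    rw [← he]
    exact ((hp.sub_const (A : ℂ)).pow 2).add_const _
  have h2 : Tendsto (fun t => √‖(p t - A) ^ 2 + (B : ℂ) ^ 2‖) l (𝓝 0) := by
    simpa using h1.norm.sqrt
  have h3 : Tendsto (fun t => R (p t)) l (𝓝 0) := by
    rw [tendsto_zero_iff_norm_tendsto_zero]
    refine h2.congr' ?_
    filter_upwards [hpS] with t ht
    rw [← h.2.1 _ ht, norm_pow, Real.sqrt_sq (norm_nonneg _)]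
  simpa using (hp.sub_const (A : ℂ)).add h3

lemma arg_eq_pi_div_two_sub_arctan {p q : ℝ} (hq : 0 < 1 + q) :
    Complex.arg ((1 + q) * (p + Complex.I)) = Real.pi / 2 - Real.arctan p := by
  have h1 := Real.arctan_lt_pi_div_two p
  have h2 := Real.neg_pi_div_two_lt_arctan p
  have hs : 0 < √(1 + p ^ 2) := Real.sqrt_pos.2 (by positivity)
  have := Complex.arg_mul_cos_add_sin_mul_I (r := (1 + q) * √(1 + p ^ 2))
    (θ := Real.pi / 2 - Real.arctan p) (by positivity)
    ⟨by linarith [Real.pi_pos], by linarith [Real.pi_pos]⟩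
  rw [← this]
  congr 1
  rw [← Complex.ofReal_cos, ← Complex.ofReal_sin, Real.cos_pi_div_two_sub,
    Real.sin_pi_div_two_sub, Real.sin_arctan, Real.cos_arctan]
  have hsc : (√(1 + p ^ 2) : ℂ) ≠ 0 := by exact_mod_cast hs.ne'
  push_cast
  field_simp

/-- The formula for the phase along any admissible paths. -/
lemma IsGenusZero.phase_eq {χ τ a b u v : ℝ} {S : Set ℂ} {R : ℂ → ℂ} {p q : ℝ → ℂ} {x y : ℝ}
    (hG : IsGenusZero χ τ a b u v S R)
    (hp : IsPath {z | z.im < 0} S R (-Complex.I) ((a : ℂ) - b * Complex.I) p)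
    (hq : IsPath {z | 0 < z.im} S R ((a : ℂ) + b * Complex.I) Complex.I q)
    (hy : 0 < 1 + y) (hA : a = -(x * y)) (hB2 : b ^ 2 = densityOf x y)
    (h1 : R Complex.I = x + y * Complex.I) (h2 : R (-Complex.I) = x - y * Complex.I) :
    ((χ * a + τ * (a ^ 2 - 1 / 2 * b ^ 2) : ℝ) : ℂ) + Complex.I * pathIntegral R p
      + Complex.I * pathIntegral R q = (phaseOf χ τ x y : ℝ) := by
  have hB := hG.pos
  have hS := hG.cut.isCompact
  have e1 : ∀ᶠ t : ℝ in 𝓝[>] 0, t ∈ Ioo (0 : ℝ) 1 := Ioo_mem_nhdsGT one_pos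
  have e2 : ∀ᶠ t : ℝ in 𝓝[<] 1, t ∈ Ioo (0 : ℝ) 1 := Ioo_mem_nhdsLT one_pos
  have hW1 : Complex.I - a + R Complex.I = (1 + y) * (x + Complex.I) := by
    rw [h1, hA]; push_cast; ring
  have hW2 : -Complex.I - a + R (-Complex.I)
      = (starRingEnd ℂ) ((1 + y) * (x + Complex.I)) := by
    rw [h2, hA]; simp; ring
  have c1 := (hG.root.continuousAt hS hG.cut.2.2.1).tendsto
  have c2 := (hG.root.continuousAt hS hG.cut.2.2.2).tendsto
  have him : ((1 + y : ℂ) * (x + Complex.I)).im = 1 + y := by simp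
  have i1 := hq.pathIntegral_eq hG.root hS hB.ne' (fun z hz => ne_of_gt hz)
    (hG.root.tendsto_branch hq.tendsto_source (e1.mono fun t ht => hq.notMem t ht)
      (by linear_combination ((b : ℂ) ^ 2) * Complex.I_sq))
    ((hq.tendsto_target.sub_const (a : ℂ)).add (c1.comp hq.tendsto_target))
    (Or.inr (by simpa using hB.ne')) (Or.inr (by rw [hW1, him]; exact hy.ne'))
  have i2 := hp.pathIntegral_eq hG.root hS hB.ne' (fun z hz => ne_of_lt hz)
    ((hp.tendsto_source.sub_const (a : ℂ)).add (c2.comp hp.tendsto_source))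
    (hG.root.tendsto_branch hp.tendsto_target (e2.mono fun t ht => hp.notMem t ht)
      (by linear_combination ((b : ℂ) ^ 2) * Complex.I_sq))
    (Or.inr (by rw [hW2, Complex.conj_im, him]; exact neg_ne_zero.2 hy.ne'))
    (Or.inr (by simpa using hB.ne'))
  have a1 := arg_eq_pi_div_two_sub_arctan (p := x) hy
  have a2 : Complex.arg ((a : ℂ) + b * Complex.I - a) = Real.pi / 2 := by
    rw [Complex.arg_eq_pi_div_two_iff]; simpa using hB
  have n1 : Complex.arg ((1 + y : ℂ) * (x + Complex.I)) ≠ Real.pi := by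
    rw [a1]; linarith [Real.neg_pi_div_two_lt_arctan x, Real.pi_pos]
  have n2 : Complex.arg ((a : ℂ) + b * Complex.I - a) ≠ Real.pi := by
    rw [a2]; linarith [Real.pi_pos]
  have hcj : (a : ℂ) - b * Complex.I - a = (starRingEnd ℂ) ((a : ℂ) + b * Complex.I - a) := by
    simp
  rw [hW1] at i1
  rw [hW2, hcj, Complex.log_conj _ n1, Complex.log_conj _ n2] at i2
  -- The logarithms occur in conjugate pairs, so the moduli cancel and the sum of the integrals
  -- times i is -2(arg((1 + y)(x + i)) - π/2) = 2 arctan x.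
  rw [i1, i2, phaseOf, ← hB2, hA]
  apply Complex.ext
  · simp only [Complex.add_re, Complex.ofReal_re, Complex.mul_re, Complex.I_re, Complex.I_im,
      Complex.sub_im, Complex.conj_im, Complex.log_im, a1, ← hA, a2]
    rw [hA]
    ring
  · simp only [Complex.add_im, Complex.ofReal_im, Complex.mul_im, Complex.I_re, Complex.I_im,
      Complex.sub_re, Complex.conj_re]
    ring

/-! ### Circular cuts with explicit root functions and paths -/

lemma sq_mul_add_ne_zero {κ : ℂ} (hκ : 0 < κ.re) {s t : ℝ} (hs : 0 ≤ s) (ht : 0 ≤ t)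
    (hst : 0 < s + t) : κ ^ 2 * s + t ≠ 0 := by
  intro h
  -- Multiplying by conj κ makes the real part equal to Re κ · (|κ|² s + t), a sum of nonnegative
  -- terms.
  have h1 : κ * (Complex.normSq κ * s : ℝ) + conj κ * t = 0 := by
    rw [Complex.ofReal_mul, ← Complex.mul_conj]
    linear_combination conj κ * h
  have h2 := congrArg Complex.re h1
  simp only [Complex.add_re, Complex.re_mul_ofReal, Complex.conj_re, Complex.zero_re] at h2
  have hn : 0 < Complex.normSq κ :=
    Complex.normSq_pos.2 (by rintro rfl; simp at hκ)
  have h3 : Complex.normSq κ * s + t = 0 := by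
    refine mul_left_cancel₀ hκ.ne' ?_
    linear_combination h2
  have h4 : 0 ≤ Complex.normSq κ * s := by positivity
  have ht0 : t = 0 := by linarith
  have hs0 : s = 0 := by
    have : Complex.normSq κ * s = 0 := by linarith
    exact (mul_eq_zero.1 this).resolve_left hn.ne'
  linarith

lemma sq_mem_slitPlane {κ : ℂ} (hκ : 0 < κ.re) : κ ^ 2 ∈ Complex.slitPlane := by
  by_contra hc
  rw [Complex.mem_slitPlane_iff_not_le_zero, not_not, Complex.le_def] at hc
  have hre : (κ ^ 2).re ≤ 0 := hc.1
  refine sq_mul_add_ne_zero hκ zero_le_one (neg_nonneg.2 hre) (by linarith) ?_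
  apply Complex.ext
  · simp
  · simpa using hc.2

/-- A circular arc from `conj a` to `a`. -/
def cutArc (a κ : ℂ) (t : ℝ) : ℂ := (a * κ ^ 2 * t + conj a * (1 - t)) / (κ ^ 2 * t + (1 - t))

/-- The branch of the square root of `(z - a) (z - conj a)` with cut along `cutArc a κ`. -/
def cutRoot (a κ z : ℂ) : ℂ := (z - a) * κ * ((z - conj a) / ((z - a) * κ ^ 2)) ^ (2⁻¹ : ℂ)

lemma cutArc_denom_ne_zero {κ : ℂ} (hκ : 0 < κ.re) {t : ℝ} (ht : t ∈ Icc (0 : ℝ) 1) :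
    κ ^ 2 * t + (1 - t) ≠ 0 := by
  have := sq_mul_add_ne_zero hκ ht.1 (sub_nonneg.2 ht.2) (by linarith)
  simpa using this

/-- In the Möbius coordinate (z - conj a)/(z - a) the arc is the ray from 0 to ∞ in direction -κ²,
which is precisely where the principal root in `cutRoot` jumps. -/
lemma mem_cutArc_iff {a κ z : ℂ} (hκ : 0 < κ.re) : z ∈ cutArc a κ '' Icc 0 1 ↔
    ∃ t ∈ Icc (0 : ℝ) 1, κ ^ 2 * t * (z - a) + (1 - t) * (z - conj a) = 0 := by
  refine exists_congr fun t => and_congr_right fun ht => ?_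
  rw [cutArc, div_eq_iff (cutArc_denom_ne_zero hκ ht)]
  constructor <;> intro h <;> linear_combination -h

lemma mem_cutArc_of_pos {a κ z : ℂ} (hκ : 0 < κ.re) {s t : ℝ} (hs : 0 ≤ s) (ht : 0 ≤ t)
    (hst : 0 < s + t) (h : κ ^ 2 * s * (z - a) + t * (z - conj a) = 0) :
    z ∈ cutArc a κ '' Icc 0 1 := by
  rw [mem_cutArc_iff hκ]
  refine ⟨s / (s + t), ⟨by positivity, by rw [div_le_one hst]; linarith⟩, ?_⟩
  have hc : (s : ℂ) + t ≠ 0 := by exact_mod_cast hst.ne'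
  push_cast
  field_simp
  linear_combination h

/-- The branch is evaluated by exhibiting a square root y in the right half-plane of the argument of
the principal root; such a y also certifies that z is off the cut. -/
lemma cutRoot_eq {a κ z y : ℂ} (hκ : 0 < κ.re) (hy : 0 < y.re) (hz : z ≠ a)
    (h : z - conj a = κ ^ 2 * y ^ 2 * (z - a)) :
    z ∉ cutArc a κ '' Icc 0 1 ∧ cutRoot a κ z = (z - a) * κ * y := by
  have hκ0 : κ ≠ 0 := by rintro rfl; simp at hκ
  have hza := sub_ne_zero.2 hz
  constructor
  · rw [mem_cutArc_iff hκ]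
    rintro ⟨t, ht, he⟩
    rw [h] at he
    have h1 : (κ ^ 2 * (z - a)) * (y ^ 2 * (1 - t : ℝ) + t) = 0 := by
      push_cast; linear_combination he
    exact (mul_ne_zero (mul_ne_zero (pow_ne_zero 2 hκ0) hza)
      (sq_mul_add_ne_zero hy (sub_nonneg.2 ht.2) ht.1 (by linarith))) h1
  · rw [cutRoot, h, show κ ^ 2 * y ^ 2 * (z - a) / ((z - a) * κ ^ 2) = y ^ 2 by field_simp,
      Complex.sq_cpow_two_inv hy]

lemma isBranchCut_cutArc {a κ : ℂ} (ha : 0 < a.im) (hκ : 0 < κ.re)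
    (hI : Complex.I ∉ cutArc a κ '' Icc 0 1) (hI' : -Complex.I ∉ cutArc a κ '' Icc 0 1) :
    IsBranchCut a.re a.im (cutArc a κ '' Icc 0 1) := by
  have hκ0 : κ ≠ 0 := by rintro rfl; simp at hκ
  have ha0 : a - conj a ≠ 0 := by
    intro h
    have := congrArg Complex.im h
    simp at this
    linarith
  refine ⟨⟨cutArc a κ, ?_, ?_, ?_, ?_, rfl⟩, ?_, hI, hI'⟩
  · unfold cutArc
    refine ContinuousOn.div (by fun_prop) (by fun_prop) fun t ht => cutArc_denom_ne_zero hκ ht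
  · intro s hs t ht h
    rw [cutArc, cutArc, div_eq_div_iff (cutArc_denom_ne_zero hκ hs)
      (cutArc_denom_ne_zero hκ ht)] at h
    have h1 : (a - conj a) * κ ^ 2 * ((s : ℂ) - t) = 0 := by linear_combination h
    have h2 := (mul_eq_zero.1 h1).resolve_left (mul_ne_zero ha0 (pow_ne_zero 2 hκ0))
    exact_mod_cast sub_eq_zero.1 h2
  · apply Complex.ext <;> simp [cutArc]
  · have : cutArc a κ 1 = a := by simp [cutArc, hκ0]
    rw [this, Complex.re_add_im]
  · intro z hz
    obtain ⟨t, ht, h⟩ := (mem_cutArc_iff hκ).1 hz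
    have h' := congrArg conj h
    simp only [map_add, map_mul, map_sub, map_pow, map_one, map_zero, Complex.conj_ofReal,
      Complex.conj_conj] at h'
    have hn : (Complex.normSq κ : ℂ) = κ * conj κ := (Complex.mul_conj κ).symm
    have hpos : 0 < Complex.normSq κ := Complex.normSq_pos.2 hκ0
    have h1t := sub_nonneg.2 ht.2
    -- Conjugating the equation of the arc swaps a and conj a. After multiplication by κ² it has the
    -- same form, with weights 1 - t and |κ|⁴ t.
    refine mem_cutArc_of_pos hκ (s := 1 - t) (t := Complex.normSq κ ^ 2 * t) h1t
      (by have := ht.1; positivity) ?_ ?_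
    · rcases ht.1.lt_or_eq with h0 | h0
      · have : 0 < Complex.normSq κ ^ 2 * t := by positivity
        linarith
      · rw [← h0]; norm_num
    · push_cast
      rw [hn]
      linear_combination κ ^ 2 * h'

lemma ne_and_mem_slitPlane_of_notMem {a κ z : ℂ} (hκ : 0 < κ.re)
    (hz : z ∉ cutArc a κ '' Icc 0 1) :
    z ≠ a ∧ (z - conj a) / ((z - a) * κ ^ 2) ∈ Complex.slitPlane := by
  have hκ0 : κ ≠ 0 := by rintro rfl; simp at hκ
  have hza : z ≠ a := by
    rintro rfl
    exact hz (mem_cutArc_of_pos hκ zero_le_one le_rfl (by norm_num) (by simp))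
  refine ⟨hza, ?_⟩
  have hza' := sub_ne_zero.2 hza
  by_contra hc
  rw [Complex.mem_slitPlane_iff_not_le_zero, not_not, Complex.le_def] at hc
  obtain ⟨x, hx⟩ : ∃ x : ℝ, (z - conj a) / ((z - a) * κ ^ 2) = x :=
    ⟨_, Complex.ext rfl (by simpa using hc.2)⟩
  rw [hx] at hc
  have hx0 : x ≤ 0 := by simpa using hc.1
  rw [div_eq_iff (mul_ne_zero hza' (pow_ne_zero 2 hκ0))] at hx
  refine hz (mem_cutArc_of_pos hκ (neg_nonneg.2 hx0) zero_le_one (by linarith) ?_)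
  push_cast
  linear_combination hx

lemma isRootFunction_cutRoot {a κ : ℂ} (hκ : 0 < κ.re) :
    IsRootFunction a.re a.im (cutArc a κ '' Icc 0 1) (cutRoot a κ) := by
  have hκ0 : κ ≠ 0 := by rintro rfl; simp at hκ
  have hfac : ∀ z : ℂ, (z - a.re) ^ 2 + (a.im : ℂ) ^ 2 = (z - a) * (z - conj a) := by
    intro z
    have h1 : conj a = a.re - a.im * Complex.I := by apply Complex.ext <;> simp
    have h2 := (Complex.re_add_im a).symm
    rw [h1]
    linear_combination (a.im : ℂ) ^ 2 * Complex.I_sq + (z - a.re + a.im * Complex.I) * h2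
  have hc : IsCompact (cutArc a κ '' Icc 0 1) := by
    refine isCompact_Icc.image_of_continuousOn ?_
    unfold cutArc
    exact ContinuousOn.div (by fun_prop) (by fun_prop) fun t ht => cutArc_denom_ne_zero hκ ht
  have hev : ∀ᶠ z in cobounded ℂ, z ∉ cutArc a κ '' Icc 0 1 := isBounded_def.1 hc.isBounded
  refine ⟨fun z hz => ?_, fun z hz => ?_, ?_⟩
  · obtain ⟨h1, h2⟩ := ne_and_mem_slitPlane_of_notMem hκ hz
    have h3 : (z - a) * κ ^ 2 ≠ 0 := mul_ne_zero (sub_ne_zero.2 h1) (pow_ne_zero 2 hκ0)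
    unfold cutRoot
    have h4 : DifferentiableAt ℂ (fun z => (z - conj a) / ((z - a) * κ ^ 2)) z := by
      fun_prop (disch := assumption)
    exact (((differentiableAt_id.sub_const a).mul_const κ).mul
      (h4.cpow_const h2)).differentiableWithinAt
  · obtain ⟨h1, -⟩ := ne_and_mem_slitPlane_of_notMem hκ hz
    have h1 := sub_ne_zero.2 h1
    rw [hfac, cutRoot, mul_pow]
    have := Complex.cpow_nat_inv_pow ((z - conj a) / ((z - a) * κ ^ 2)) (two_ne_zero)
    rw [Nat.cast_ofNat] at this
    rw [this]
    field_simp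
  · have hinv : Tendsto (fun z : ℂ => z⁻¹) (cobounded ℂ) (𝓝 0) := tendsto_inv₀_cobounded
    have hw : Tendsto (fun z : ℂ => (z - conj a) / ((z - a) * κ ^ 2)) (cobounded ℂ)
        (𝓝 ((κ⁻¹) ^ 2)) := by
      have h1 : Tendsto (fun z : ℂ => (1 - conj a * z⁻¹) / ((1 - a * z⁻¹) * κ ^ 2)) (cobounded ℂ)
          (𝓝 ((1 - conj a * 0) / ((1 - a * 0) * κ ^ 2))) :=
        ((hinv.const_mul _).const_sub 1).div (((hinv.const_mul _).const_sub 1).mul_const _)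
          (by simpa using hκ0)
      have h2 : (1 - conj a * 0) / ((1 - a * 0) * κ ^ 2) = (κ⁻¹) ^ 2 := by
        rw [mul_zero, mul_zero, sub_zero, one_mul, one_div, inv_pow]
      rw [h2] at h1
      refine h1.congr' ?_
      filter_upwards [eventually_ne_cobounded 0] with z hz
      have e1 : 1 - conj a * z⁻¹ = (z - conj a) * z⁻¹ := by field_simp
      have e2 : 1 - a * z⁻¹ = (z - a) * z⁻¹ := by field_simp
      rw [e1, e2, mul_right_comm, mul_div_mul_right _ _ (inv_ne_zero hz)]
    have hκi : 0 < (κ⁻¹).re := by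
      rw [Complex.inv_re]; exact div_pos hκ (Complex.normSq_pos.2 hκ0)
    have hg : Tendsto (fun z : ℂ => κ * ((z - conj a) / ((z - a) * κ ^ 2)) ^ (2⁻¹ : ℂ))
        (cobounded ℂ) (𝓝 1) := by
      have h1 := (continuousAt_cpow_const (b := 2⁻¹) (sq_mem_slitPlane hκi)).tendsto.comp hw
      rw [Complex.sq_cpow_two_inv hκi] at h1
      have h2 := h1.const_mul κ
      rwa [mul_inv_cancel₀ hκ0] at h2
    set g : ℂ → ℂ := fun z => κ * ((z - conj a) / ((z - a) * κ ^ 2)) ^ (2⁻¹ : ℂ) with hgdef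
    -- Here R = (z - a)g with g²(z - a) = z - conj a, so R - z = (z - a)(g - 1) - a = (a - conj
    -- a)/(g + 1) - a, which is bounded since g → 1.
    have h2 : Tendsto (fun z => (a - conj a) / (g z + 1) - a) (cobounded ℂ)
        (𝓝 ((a - conj a) / (1 + 1) - a)) :=
      (tendsto_const_nhds.div (hg.add_const 1) (by norm_num)).sub_const a
    refine (h2.isBigO_one ℂ).congr' ?_ EventuallyEq.rfl
    have hg1 : ∀ᶠ z in cobounded ℂ, g z + 1 ≠ 0 :=
      (hg.add_const 1).eventually_ne (by norm_num)
    filter_upwards [hev, hg1] with z hz hz1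
    obtain ⟨h1, -⟩ := ne_and_mem_slitPlane_of_notMem hκ hz
    have h1 := sub_ne_zero.2 h1
    have h3 : g z ^ 2 * (z - a) = z - conj a := by
      simp only [hgdef]
      rw [mul_pow]
      have := Complex.cpow_nat_inv_pow ((z - conj a) / ((z - a) * κ ^ 2)) (two_ne_zero)
      rw [Nat.cast_ofNat] at this
      rw [this]
      field_simp
    have h4 : cutRoot a κ z = (z - a) * g z := by
      simp only [hgdef, cutRoot]; ring
    rw [h4]
    field_simp
    linear_combination -h3

/-- A circular arc starting at `a`. -/
def arcPath (a K : ℂ) (t : ℝ) : ℂ := a + (a - conj a) * t ^ 2 / (K - t ^ 2)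

lemma arcPath_denom_ne_zero {K : ℂ} (hK : 1 < ‖K‖) {t : ℝ} (ht : t ∈ Icc (0 : ℝ) 1) :
    K - (t : ℂ) ^ 2 ≠ 0 := by
  intro h
  rw [sub_eq_zero.1 h, norm_pow, Complex.norm_real, Real.norm_eq_abs, abs_of_nonneg ht.1] at hK
  have := pow_le_one₀ (n := 2) ht.1 ht.2
  linarith

lemma hasDerivAt_arcPath {a K : ℂ} (hK : 1 < ‖K‖) {t : ℝ} (ht : t ∈ Icc (0 : ℝ) 1) :
    HasDerivAt (arcPath a K) ((a - conj a) * (2 * t * K) / (K - t ^ 2) ^ 2) t := by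
  have h0 := arcPath_denom_ne_zero hK ht
  have h1 : HasDerivAt (fun t : ℝ => (t : ℂ) ^ 2) (2 * (t : ℂ)) t := by
    simpa using (Complex.ofRealCLM.hasDerivAt (x := t)).fun_pow 2
  refine (((h1.const_mul (a - conj a)).fun_div (h1.const_sub K) h0).const_add a).congr_deriv ?_
  field_simp
  ring

lemma conj_arcPath (a K : ℂ) (t : ℝ) : conj (arcPath a K t) = arcPath (conj a) (conj K) t := by
  simp [arcPath]

/-- Along the path the Möbius coordinate (z - conj a)/(z - a) is K/t², a ray of constant argument.
With K = κ⁴ it avoids the direction -κ² of the cut. Using t² rather than t makes dz/R bounded at the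
branch point. -/
lemma arcPath_sub {a K : ℂ} (hK : 1 < ‖K‖) {t : ℝ} (ht : t ∈ Icc (0 : ℝ) 1) :
    arcPath a K t - a = (a - conj a) / (K - t ^ 2) * t ^ 2 ∧
    arcPath a K t - conj a = (a - conj a) / (K - t ^ 2) * K := by
  have h0 := arcPath_denom_ne_zero hK ht
  rw [arcPath]
  constructor
  · field_simp
    ring
  · field_simp
    ring

/-- Since |K| > 1 ≥ t², the point is closer to a than to conj a, hence in the upper half-plane. -/
lemma im_arcPath_pos {a K : ℂ} (ha : 0 < a.im) (hK : 1 < ‖K‖) {t : ℝ} (ht : t ∈ Icc (0 : ℝ) 1) :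
    0 < (arcPath a K t).im := by
  obtain ⟨h1, h2⟩ := arcPath_sub (a := a) hK ht
  have h0 := arcPath_denom_ne_zero hK ht
  have ha0 : a - conj a ≠ 0 := by
    intro h
    have := congrArg Complex.im h
    simp at this
    linarith
  have n1 := congrArg Complex.normSq h1
  have n2 := congrArg Complex.normSq h2
  rw [Complex.normSq_mul] at n1 n2
  have hc : 0 < Complex.normSq ((a - conj a) / (K - t ^ 2)) :=
    Complex.normSq_pos.2 (div_ne_zero ha0 h0)
  have hlt : Complex.normSq ((t : ℂ) ^ 2) < Complex.normSq K := by
    rw [Complex.normSq_eq_norm_sq, Complex.normSq_eq_norm_sq]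
    refine pow_lt_pow_left₀ (lt_of_le_of_lt ?_ hK) (norm_nonneg _) two_ne_zero
    rw [norm_pow, Complex.norm_real, Real.norm_eq_abs, abs_of_nonneg ht.1]
    exact pow_le_one₀ ht.1 ht.2
  have hlt' := mul_lt_mul_of_pos_left hlt hc
  rw [← n1, ← n2, Complex.normSq_apply, Complex.normSq_apply] at hlt'
  simp only [Complex.sub_re, Complex.sub_im, Complex.conj_re, Complex.conj_im] at hlt'
  have : 0 < a.im * (arcPath a K t).im := by linarith
  exact pos_of_mul_pos_right this ha.le

lemma intervalIntegrable_of_eqOn_Ioo {f g : ℝ → ℂ} (hg : ContinuousOn g (Icc 0 1))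
    (h : ∀ t ∈ Ioo (0 : ℝ) 1, f t = g t) :
    IntervalIntegrable f MeasureTheory.volume 0 1 := by
  rw [intervalIntegrable_iff_integrableOn_Ioo_of_le zero_le_one]
  have h1 := hg.intervalIntegrable_of_Icc (μ := MeasureTheory.volume) zero_le_one
  rw [intervalIntegrable_iff_integrableOn_Ioo_of_le zero_le_one] at h1
  exact h1.congr_fun (fun t ht => (h t ht).symm) measurableSet_Ioo

/-- A cut, a root function and paths of integration with a prescribed value `κ ^ 2 * (i - a)` of
the root function at `i`. -/
lemma exists_cut_and_paths {a κ : ℂ} (ha : 0 < a.im) (hκ : 0 < κ.re)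
    (hI : Complex.I - conj a = κ ^ 4 * (Complex.I - a)) :
    ∃ (S : Set ℂ) (R : ℂ → ℂ) (p q : ℝ → ℂ), IsBranchCut a.re a.im S ∧
      IsRootFunction a.re a.im S R ∧ R Complex.I = κ ^ 2 * (Complex.I - a) ∧
      R (-Complex.I) = conj (κ ^ 2 * (Complex.I - a)) ∧
      IsPath {z | z.im < 0} S R (-Complex.I) (conj a) p ∧
      IsPath {z | 0 < z.im} S R a Complex.I q := by
  have hκ0 : κ ≠ 0 := by rintro rfl; simp at hκ
  have hκc : conj κ ≠ 0 := (map_ne_zero _).2 hκ0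
  have ha0 : a - conj a ≠ 0 := by
    intro h
    have := congrArg Complex.im h
    simp at this
    linarith
  have haI : Complex.I - a ≠ 0 := by
    intro h
    rw [h, mul_zero] at hI
    apply ha0
    linear_combination hI - h
  have hI' : -Complex.I - a = conj κ ^ 4 * (-Complex.I - conj a) := by
    simpa using congrArg conj hI
  have haI' : -Complex.I - a ≠ 0 := by
    rw [hI']
    refine mul_ne_zero (pow_ne_zero 4 hκc) ?_
    have := (map_ne_zero conj).2 haI
    simpa using this
  -- κ⁴ is the Möbius coordinate of i, and i is closer to a than to conj a.
  have hK : 1 < ‖κ ^ 4‖ := by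
    have h1 : Complex.normSq (Complex.I - a) < Complex.normSq (Complex.I - conj a) := by
      rw [Complex.normSq_apply, Complex.normSq_apply]
      simp
      nlinarith
    rw [hI, Complex.normSq_mul] at h1
    have h2 : 1 < Complex.normSq (κ ^ 4) := by
      by_contra! hc
      have := mul_le_mul_of_nonneg_right hc (Complex.normSq_nonneg (Complex.I - a))
      linarith
    rw [Complex.normSq_eq_norm_sq] at h2
    by_contra! hc
    have := pow_le_one₀ (n := 2) (norm_nonneg _) hc
    linarith
  have hKc : 1 < ‖conj (κ ^ 4)‖ := by rwa [RCLike.norm_conj]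
  have hnorm : (conj κ ^ 2 * κ) = (Complex.normSq κ : ℂ) * conj κ := by
    rw [← Complex.mul_conj]; ring
  have hpos : 0 < Complex.normSq κ := Complex.normSq_pos.2 hκ0
  have hlow : 0 < ((conj κ ^ 2 * κ)⁻¹).re := by
    rw [Complex.inv_re]
    refine div_pos ?_ (Complex.normSq_pos.2 (mul_ne_zero (pow_ne_zero 2 hκc) hκ0))
    rw [hnorm, Complex.re_ofReal_mul, Complex.conj_re]
    positivity
  -- At i the square root to exhibit is κ itself; at -i it is the inverse of (conj κ)²κ = |κ|² conj
  -- κ, again in the right half-plane.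
  have vI := cutRoot_eq hκ hκ (sub_ne_zero.1 haI) (by linear_combination hI)
  have vI' := cutRoot_eq (y := (conj κ ^ 2 * κ)⁻¹) hκ hlow (sub_ne_zero.1 haI')
    (by rw [hI']; field_simp)
  have vup : ∀ t ∈ Ioo (0 : ℝ) 1, arcPath a (κ ^ 4) t ∉ cutArc a κ '' Icc 0 1 ∧
      cutRoot a κ (arcPath a (κ ^ 4) t) = (a - conj a) / (κ ^ 4 - t ^ 2) * t * κ ^ 2 := by
    intro t ht
    have ht' : t ∈ Icc (0 : ℝ) 1 := ⟨ht.1.le, ht.2.le⟩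
    have ht0 : (t : ℂ) ≠ 0 := by exact_mod_cast ht.1.ne'
    have hd := arcPath_denom_ne_zero hK ht'
    obtain ⟨h1, h2⟩ := arcPath_sub (a := a) hK ht'
    have hy : 0 < (κ * (t⁻¹ : ℝ)).re := by
      rw [Complex.re_mul_ofReal]; exact mul_pos hκ (inv_pos.2 ht.1)
    have hne : arcPath a (κ ^ 4) t ≠ a := by
      rw [← sub_ne_zero, h1]
      exact mul_ne_zero (div_ne_zero ha0 hd) (pow_ne_zero 2 ht0)
    obtain ⟨h3, h4⟩ := cutRoot_eq (y := κ * (t⁻¹ : ℝ)) hκ hy hne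
      (by rw [h1, h2]; push_cast; field_simp)
    refine ⟨h3, ?_⟩
    rw [h4, h1]
    push_cast
    field_simp
  have vlow : ∀ s ∈ Ioo (0 : ℝ) 1, conj (arcPath a (κ ^ 4) s) ∉ cutArc a κ '' Icc 0 1 ∧
      cutRoot a κ (conj (arcPath a (κ ^ 4) s))
        = conj ((a - conj a) / (κ ^ 4 - s ^ 2) * s * κ ^ 2) := by
    intro t ht
    have ht' : t ∈ Icc (0 : ℝ) 1 := ⟨ht.1.le, ht.2.le⟩
    have ht0 : (t : ℂ) ≠ 0 := by exact_mod_cast ht.1.ne'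
    have hd := arcPath_denom_ne_zero hKc ht'
    obtain ⟨h1, h2⟩ := arcPath_sub (a := conj a) hKc ht'
    rw [Complex.conj_conj] at h1 h2
    rw [conj_arcPath]
    have ha0' : conj a - a ≠ 0 := by rw [← neg_sub]; exact neg_ne_zero.2 ha0
    have hy : 0 < ((conj κ ^ 2 * κ)⁻¹ * (t : ℝ)).re := by
      rw [Complex.re_mul_ofReal]; exact mul_pos hlow ht.1
    have hne : arcPath (conj a) (conj (κ ^ 4)) t ≠ a := by
      rw [← sub_ne_zero, h2]
      exact mul_ne_zero (div_ne_zero ha0' hd) ((map_ne_zero _).2 (pow_ne_zero 4 hκ0))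
    obtain ⟨h3, h4⟩ := cutRoot_eq (y := (conj κ ^ 2 * κ)⁻¹ * (t : ℝ)) hκ hy hne
      (by rw [h1, h2, map_pow]; field_simp)
    refine ⟨h3, ?_⟩
    rw [h4, h2]
    rw [map_pow] at hd
    simp only [map_mul, map_div₀, map_sub, map_pow, Complex.conj_conj, Complex.conj_ofReal]
    field_simp
  have harc1 : arcPath a (κ ^ 4) 1 = Complex.I := by
    have hd := arcPath_denom_ne_zero hK (right_mem_Icc.2 zero_le_one)
    obtain ⟨h1, h2⟩ := arcPath_sub (a := a) hK (right_mem_Icc.2 zero_le_one)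
    rw [Complex.ofReal_one, one_pow] at hd
    rw [arcPath, Complex.ofReal_one, one_pow]
    field_simp
    linear_combination hI
  have harc0 : arcPath a (κ ^ 4) 0 = a := by simp [arcPath]
  have hdiff : ∀ t ∈ Icc (0 : ℝ) 1, HasDerivAt (fun t : ℝ => conj (arcPath a (κ ^ 4) (1 - t)))
      (-((conj a - a) * (2 * (1 - t : ℝ) * conj (κ ^ 4)) /
        (conj (κ ^ 4) - (1 - t : ℝ) ^ 2) ^ 2)) t := by
    intro t ht
    have ht' : 1 - t ∈ Icc (0 : ℝ) 1 := ⟨by linarith [ht.2], by linarith [ht.1]⟩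
    have h := hasDerivAt_arcPath (a := conj a) hKc ht'
    rw [Complex.conj_conj] at h
    have h2 := h.scomp t ((hasDerivAt_id' t).const_sub 1)
    simp only [conj_arcPath]
    exact h2.congr_deriv (by simp)
  refine ⟨cutArc a κ '' Icc 0 1, cutRoot a κ, fun t => conj (arcPath a (κ ^ 4) (1 - t)),
    arcPath a (κ ^ 4), isBranchCut_cutArc ha hκ vI.1 vI'.1, isRootFunction_cutRoot hκ, ?_, ?_,
    ⟨?_, ?_, ?_, ?_, ?_, ?_, ?_⟩, ⟨?_, ?_, harc0, harc1, ?_, ?_, ?_⟩⟩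
  · rw [vI.2]; ring
  · rw [vI'.2, hI']
    simp only [map_mul, map_pow, map_sub, Complex.conj_I]
    field_simp
  · exact fun t ht => (hdiff t ht).continuousAt.continuousWithinAt
  · exact fun t ht => (hdiff t ⟨ht.1.le, ht.2.le⟩).differentiableAt.differentiableWithinAt
  · simp [harc1]
  · simp [harc0]
  · intro t ht
    have := im_arcPath_pos ha hK (t := 1 - t) ⟨by linarith [ht.2], by linarith [ht.1]⟩
    simpa using this
  · exact fun t ht => (vlow (1 - t) ⟨by linarith [ht.2], by linarith [ht.1]⟩).1
  · refine intervalIntegrable_of_eqOn_Ioo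
      (g := fun t => -(2 * conj κ ^ 2 / (conj (κ ^ 4) - (1 - t : ℝ) ^ 2))) ?_ fun t ht => ?_
    · refine (ContinuousOn.div (by fun_prop) (by fun_prop) fun t ht => ?_).neg
      exact arcPath_denom_ne_zero hKc ⟨by linarith [ht.2], by linarith [ht.1]⟩
    · have ht' : 1 - t ∈ Ioo (0 : ℝ) 1 := ⟨by linarith [ht.2], by linarith [ht.1]⟩
      have ht0 : ((1 - t : ℝ) : ℂ) ≠ 0 := by exact_mod_cast ht'.1.ne'
      have hd := arcPath_denom_ne_zero hKc ⟨ht'.1.le, ht'.2.le⟩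
      have ha0' : conj a - a ≠ 0 := by rw [← neg_sub]; exact neg_ne_zero.2 ha0
      rw [(hdiff t ⟨ht.1.le, ht.2.le⟩).deriv, (vlow (1 - t) ht').2]
      generalize 1 - t = s at *
      rw [map_pow] at *
      simp only [map_mul, map_div₀, map_sub, map_pow, Complex.conj_conj, Complex.conj_ofReal]
      field_simp
  · exact fun t ht => (hasDerivAt_arcPath hK ht).continuousAt.continuousWithinAt
  · exact fun t ht =>
      (hasDerivAt_arcPath hK ⟨ht.1.le, ht.2.le⟩).differentiableAt.differentiableWithinAt
  · exact fun t ht => im_arcPath_pos ha hK ht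
  · exact fun t ht => (vup t ht).1
  -- The factor t in the velocity cancels the zero of R at the branch point, leaving a continuous
  -- integrand.
  · refine intervalIntegrable_of_eqOn_Ioo
      (g := fun t => 2 * κ ^ 2 / (κ ^ 4 - (t : ℂ) ^ 2)) ?_ fun t ht => ?_
    · exact ContinuousOn.div (by fun_prop) (by fun_prop) fun t ht => arcPath_denom_ne_zero hK ht
    · have ht' : t ∈ Icc (0 : ℝ) 1 := ⟨ht.1.le, ht.2.le⟩
      have ht0 : (t : ℂ) ≠ 0 := by exact_mod_cast ht.1.ne'
      have hd := arcPath_denom_ne_zero hK ht'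
      rw [(hasDerivAt_arcPath hK ht').deriv, (vup t ht).2]
      field_simp

/-! ### Realizing root pairs and identifying A, B and γ -/

/-- Every complex number of the slit plane is the square of a number in the right half-plane. -/
lemma exists_sq_eq_of_mem_slitPlane {μ : ℂ} (h : μ ∈ Complex.slitPlane) :
    ∃ κ : ℂ, 0 < κ.re ∧ κ ^ 2 = μ := by
  refine ⟨μ ^ (2⁻¹ : ℂ), ?_, by simp⟩
  rw [Complex.cpow_inv_two_re]
  refine Real.sqrt_pos.2 (half_pos ?_)
  rcases h with h | h
  · positivity
  · have := Complex.abs_re_lt_norm.2 h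
    linarith [neg_abs_le μ.re]

lemma IsRootPair.exists_isGenusZero {χ τ B p q : ℝ} (h : IsRootPair χ τ p q) (hp : 0 ≤ p)
    (hq : 0 ≤ q) (hB : 0 < B) (hB2 : B ^ 2 = densityOf p q) :
    ∃ (u v : ℝ) (S : Set ℂ) (R : ℂ → ℂ) (P Q : ℝ → ℂ),
      IsGenusZero χ τ (-(p * q)) B u v S R ∧
      IsPath {z | z.im < 0} S R (-Complex.I) (((-(p * q) : ℝ) : ℂ) - B * Complex.I) P ∧
      IsPath {z | 0 < z.im} S R (((-(p * q) : ℝ) : ℂ) + B * Complex.I) Complex.I Q ∧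
      R Complex.I = p + q * Complex.I ∧ R (-Complex.I) = p - q * Complex.I := by
  obtain ⟨a, ha⟩ : ∃ a : ℂ, a = ((-(p * q) : ℝ) : ℂ) + B * Complex.I := ⟨_, rfl⟩
  have hac : conj a = ((-(p * q) : ℝ) : ℂ) - B * Complex.I := by rw [ha]; simp; ring
  have hare : a.re = -(p * q) := by rw [ha]; simp
  have haim : a.im = B := by rw [ha]; simp
  have hB2' : (B : ℂ) ^ 2 = (1 + p ^ 2) * (1 - q ^ 2) := by
    rw [densityOf] at hB2; exact_mod_cast hB2
  have hsq : ((p : ℂ) + q * Complex.I) ^ 2 = (Complex.I - a) * (Complex.I - conj a) := by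
    rw [hac, ha]
    push_cast
    linear_combination -hB2' + ((q : ℂ) ^ 2 - 1 + (B : ℂ) ^ 2) * Complex.I_sq
  have hr0 : (p : ℂ) + q * Complex.I ≠ 0 := by
    intro h0
    have e1 := congrArg Complex.re h0
    have e2 := congrArg Complex.im h0
    simp at e1 e2
    have := h.pos
    rw [e1, e2] at this
    norm_num at this
  have haI : Complex.I - a ≠ 0 := by
    intro h0
    rw [h0, zero_mul] at hsq
    exact hr0 (pow_eq_zero_iff two_ne_zero |>.1 hsq)
  -- If p + iq = x(i - a) with x ≤ 0, the real part p = xpq forces p = 0. Then B² = 1 - q² < 1, and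
  -- q = x(1 - B) contradicts q > 0.
  have hμ : ((p : ℂ) + q * Complex.I) / (Complex.I - a) ∈ Complex.slitPlane := by
    by_contra hc
    rw [Complex.mem_slitPlane_iff_not_le_zero, not_not, Complex.le_def] at hc
    obtain ⟨x, hx⟩ : ∃ x : ℝ, ((p : ℂ) + q * Complex.I) / (Complex.I - a) = x :=
      ⟨_, Complex.ext rfl (by simpa using hc.2)⟩
    rw [hx] at hc
    have hx0 : x ≤ 0 := by simpa using hc.1
    rw [div_eq_iff haI] at hx
    have e1 := congrArg Complex.re hx
    have e2 := congrArg Complex.im hx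
    simp [hare, haim] at e1 e2
    have hp0 : p = 0 := by nlinarith [mul_nonneg (mul_nonneg hp hq) (neg_nonneg.2 hx0)]
    subst hp0
    have hq0 : 0 < q := by
      refine hq.lt_of_ne ?_
      rintro rfl
      have := h.pos
      norm_num at this
    rw [densityOf] at hB2
    have hB1 : B < 1 := by nlinarith
    nlinarith
  obtain ⟨κ, hκ, hκμ⟩ := exists_sq_eq_of_mem_slitPlane hμ
  have hκr : κ ^ 2 * (Complex.I - a) = p + q * Complex.I := by
    rw [hκμ, div_mul_cancel₀ _ haI]
  obtain ⟨S, R, P, Q, hS, hR, h1, h2, hP, hQ⟩ := exists_cut_and_paths (by rw [haim]; exact hB) hκ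
    (by
      refine mul_left_cancel₀ haI ?_
      rw [← hsq, ← hκr]
      ring)
  rw [hare, haim] at hS hR
  rw [hκr] at h1 h2
  have h2' : R (-Complex.I) = p - q * Complex.I := by rw [h2]; simp; ring
  obtain ⟨u, v, hG⟩ := h.isGenusZero hB hB2 hS hR h1 h2'
  rw [hac] at hP
  rw [ha] at hQ
  exact ⟨u, v, S, R, P, Q, hG, hP, hQ, h1, h2'⟩

lemma IsRootPair.nonneg {χ τ p q : ℝ} (h : IsRootPair χ τ p q) (hχ : 0 ≤ χ) (hτ : 0 ≤ τ) :
    0 ≤ p ∧ 0 ≤ q := by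
  have hpos := h.pos
  have h1 : 0 ≤ τ * ((1 + p ^ 2) * (p ^ 2 + q ^ 2)) := by positivity
  have h2 : 0 ≤ χ * ((1 + p ^ 2) * (p ^ 2 + q ^ 2)) := by positivity
  rw [h.tau_eq] at h1
  rw [h.chi_eq] at h2
  have h3 := nonneg_of_mul_nonneg_left h2 (by positivity)
  exact ⟨by linarith, by linarith⟩

lemma densityOf_pos {p q : ℝ} (h : q ^ 2 < 1) : 0 < densityOf p q :=
  mul_pos (by positivity) (by linarith)

lemma isBranchPoint_iff {x : ℝ × ℝ} (hx : x ∈ exterior) (A B : ℝ) :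
    IsBranchPoint x.1 x.2 A B ↔
      A = -((rootPair x).1 * (rootPair x).2) ∧
        B = √(densityOf (rootPair x).1 (rootPair x).2) := by
  constructor
  · rintro ⟨u, v, S, R, h⟩
    obtain ⟨p, q, hpq, hA, hB, -, -⟩ := h.isRootPair
    rw [hpq.eq_rootPair hx]
    exact ⟨hA, by rw [← hB, Real.sqrt_sq h.pos.le]⟩
  · rintro ⟨rfl, rfl⟩
    have h := isRootPair_rootPair hx
    have hd := densityOf_pos (p := (rootPair x).1) h.sq_lt
    obtain ⟨hp, hq⟩ := h.nonneg hx.1.1 hx.1.2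
    obtain ⟨u, v, S, R, -, -, hG, -⟩ :=
      h.exists_isGenusZero hp hq (Real.sqrt_pos.2 hd) (Real.sq_sqrt hd.le)
    exact ⟨u, v, S, R, hG⟩

lemma existsUnique_isBranchPoint {x : ℝ × ℝ} (hx : x ∈ exterior) :
    ∃! w : ℝ × ℝ, IsBranchPoint x.1 x.2 w.1 w.2 := by
  simp only [isBranchPoint_iff hx]
  exact ⟨(_, _), ⟨rfl, rfl⟩, fun w hw => Prod.ext hw.1 hw.2⟩

lemma A_B_eq {χ τ : ℝ} (hx : (χ, τ) ∈ exterior) :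
    A χ τ = -((rootPair (χ, τ)).1 * (rootPair (χ, τ)).2) ∧
      B χ τ = √(densityOf (rootPair (χ, τ)).1 (rootPair (χ, τ)).2) :=
  (isBranchPoint_iff hx _ _).1 (Classical.epsilon_spec
    (p := fun w : ℝ × ℝ => IsBranchPoint χ τ w.1 w.2) (existsUnique_isBranchPoint hx).exists)

lemma rho_eq {χ τ : ℝ} (hx : (χ, τ) ∈ exterior) :
    rho χ τ = densityOf (rootPair (χ, τ)).1 (rootPair (χ, τ)).2 := by
  rw [rho, (A_B_eq hx).2, Real.sq_sqrt (densityOf_pos (isRootPair_rootPair hx).sq_lt).le]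

lemma isPhase_iff {χ τ : ℝ} (hx : (χ, τ) ∈ exterior) (g : ℝ) :
    IsPhase χ τ g ↔ g = phaseOf χ τ (rootPair (χ, τ)).1 (rootPair (χ, τ)).2 := by
  constructor
  · rintro ⟨u, v, S, R, P, Q, hG, hP, hQ, hg⟩
    obtain ⟨p, q, hpq, hA, hB, h1, h2⟩ := hG.isRootPair
    rw [hpq.eq_rootPair hx]
    rw [hG.phase_eq hP hQ (by nlinarith [hpq.sq_lt]) hA hB h1 h2] at hg
    exact_mod_cast hg
  · rintro rfl
    have h := isRootPair_rootPair hx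
    have hd := densityOf_pos (p := (rootPair (χ, τ)).1) h.sq_lt
    have hB2 := Real.sq_sqrt hd.le
    obtain ⟨hp, hq⟩ := h.nonneg hx.1.1 hx.1.2
    obtain ⟨u, v, S, R, P, Q, hG, hP, hQ, h1, h2⟩ :=
      h.exists_isGenusZero hp hq (Real.sqrt_pos.2 hd) hB2
    have he := hG.phase_eq hP hQ (by linarith) rfl hB2 h1 h2
    obtain ⟨eA, eB⟩ := A_B_eq hx
    rw [← eA, ← eB] at hG hP hQ he
    exact ⟨u, v, S, R, P, Q, hG, hP, hQ, he.symm⟩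

lemma existsUnique_isPhase {x : ℝ × ℝ} (hx : x ∈ exterior) : ∃! g : ℝ, IsPhase x.1 x.2 g := by
  simp only [isPhase_iff (χ := x.1) (τ := x.2) hx]
  exact ⟨_, rfl, fun _ h => h⟩

lemma gamma_eq {χ τ : ℝ} (hx : (χ, τ) ∈ exterior) :
    gamma χ τ = phaseOf χ τ (rootPair (χ, τ)).1 (rootPair (χ, τ)).2 :=
  (isPhase_iff hx _).1 (Classical.epsilon_spec (p := fun g : ℝ => IsPhase χ τ g)
    (existsUnique_isPhase hx).exists)

end RogueWave

end

/-- On the exterior of the closure of `𝒞` the functions `A`, `B > 0` and `γ` are well defined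
(independently of all choices), `γ`, `ρ = B²` and `U = -2γ_χ` are continuously differentiable, and
`(ρ, U)` solves the dispersionless focusing nonlinear Schrödinger system. -/
theorem corollary6 :
    (∀ x ∈ RogueWave.exterior, ∃! w : ℝ × ℝ, RogueWave.IsBranchPoint x.1 x.2 w.1 w.2) ∧
    (∀ x ∈ RogueWave.exterior, ∃! g : ℝ, RogueWave.IsPhase x.1 x.2 g) ∧
    ContDiffOn ℝ 1 (fun x : ℝ × ℝ => RogueWave.gamma x.1 x.2) RogueWave.exterior ∧
    ContDiffOn ℝ 1 (fun x : ℝ × ℝ => RogueWave.rho x.1 x.2) RogueWave.exterior ∧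
    ContDiffOn ℝ 1 (fun x : ℝ × ℝ => RogueWave.U x.1 x.2) RogueWave.exterior ∧
    ∀ χ τ : ℝ, (χ, τ) ∈ RogueWave.exterior →
      RogueWave.dTau RogueWave.rho χ τ
          + RogueWave.dChi (fun s t => RogueWave.rho s t * RogueWave.U s t) χ τ = 0 ∧
      RogueWave.dTau RogueWave.U χ τ
          + RogueWave.dChi
              (fun s t => 1 / 2 * RogueWave.U s t ^ 2 - RogueWave.rho s t) χ τ = 0 := by
  exact ⟨fun x hx => RogueWave.existsUnique_isBranchPoint hx,
    fun x hx => RogueWave.existsUnique_isPhase hx,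
    RogueWave.dispersionless_system (fun x hx => RogueWave.gamma_eq hx)
      (fun x hx => RogueWave.rho_eq hx)⟩
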